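/- Let $\mathcal G=(V,E,w)$ be a finite weighted digraph ($E\subseteq V\times V$, $w:E\to\mathbb R^+$) with $n=|V|$, adjacency matrix $A$ ($A_{ij}=w(i,j)$ if $(i,j)\in E$, and $A_{ij}=0$ otherwise), out-degrees $d_i=\sum_j A_{ij}>0$ for all $i \in V$, $D=\mathrm{diag}(d_i)$, and transition matrix $P=D^{-1}A$. Let $\alpha\in(0,1)$, $v\in V$, $S\subseteq V$, and $$\Pi=\alpha\,(I-(1-\alpha)P)^{-1},\qquad \sigma=\tfrac1n\mathbf 1^{\top}\Pi,\qquad \tilde\sigma=e_v^{\top}\Pi,\qquad \eta=\Pi\mathbf 1_S .$$ Let $\mathcal G_r$ be the digraph with the nodes and edges of $\mathcal G$ and the weights $w_r(i,j)=w(i,j)\big/\big(\tfrac{\alpha}{1-\alpha}d_i\big)$. A spanning rooted forest $F$ of $\mathcal G_r$ is an acyclic set of edges in which every node has at most one outgoing edge; the nodes without an outgoing edge are its roots, $r(F,u)$ is the root to which the edges of $F$ lead from $u$, $M(F,s)=\{u: r(F,u)=s\}$, and $\varepsilon(F)=\prod_{(i,j)\in F}w_r(i,j)$ (so $\varepsilon(\emptyset)=1$).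 Let $\mathcal F$ be the set of all these forests. The algorithm RandomForest on $\mathcal G_r$ keeps a set of finished nodes, initially empty, and arrays $Next$ and $Root$. It goes through the nodes $i$ of $V$ in a given order. For each $i$ it walks from $u=i$ until $u$ is finished: at an unfinished node $u$, with probability $1/(1+d^r_u)$, where $d^r_u=\sum_x w_r(u,x)$ is the out-degree of $u$ in $\mathcal G_r$, it declares $u$ finished and a root ($Root[u]=u$, and $Next[u]$ is empty); otherwise it chooses an out-neighbour $x$ with probability $w_r(u,x)/d^r_u$, sets $Next[u]=x$ and moves to $x$. When the walk has reached a finished node $u$, it follows $Next$ from $i$ up to the first finished node, declaring the nodes met finished and giving them the root $Root[u]$. The forest returned has the edges $(u,Next[u])$. Then RandomForest terminates almost surely; it returns each $F\in\mathcal F$ with probability $\varepsilon(F)/\sum_{F'\in\mathcal F}\varepsilon(F')$, and its array $Root$ is then $u\mapsto r(F,u)$. Moreover, let $\epsilon>0$, $\delta\in(0,1)$ and $\psi=\left\lceil\frac1{2\epsilon^2}\ln\frac2\delta\right\rceil$, and let $F_1,\dots,F_\psi$ be the forests returned by $\psi$ independent runs of RandomForest on $\mathcal G_r$. Then for every $s\in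 V$, $$\mathbb P\Big\{\Big|\frac1\psi\sum_{i=1}^{\psi}\frac{|M(F_i,s)|}{n}-\sigma_s\Big|>\epsilon\Big\}\le\delta,\qquad \mathbb P\Big\{\Big|\frac1\psi\sum_{i=1}^{\psi}\mathbf 1_{r(F_i,v)=s}-\tilde\sigma_s\Big|>\epsilon\Big\}\le\delta,\qquad \mathbb P\Big\{\Big|\frac1\psi\sum_{i=1}^{\psi}\mathbf 1_{r(F_i,s)\in S}-\eta_s\Big|>\epsilon\Big\}\le\delta .$$ -/

import Mathlib

open MeasureTheory ProbabilityTheory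

/-- A weighted digraph `(V, E, w)`: `Adj i j` means `(i, j) ∈ E` (loops are allowed), and `w` is
positive on `E`; the values of `w` outside `E` are never used. -/
structure WDigraph (V : Type*) where
  Adj : V → V → Prop
  w : V → V → ℝ
  w_pos : ∀ i j, Adj i j → 0 < w i j

namespace WDigraph

variable {V : Type*}

open Classical in
/-- The adjacency matrix `A`. -/
noncomputable def adjMatrix (G : WDigraph V) : Matrix V V ℝ :=
  Matrix.of fun i j => if G.Adj i j then G.w i j else 0

theorem adjMatrix_nonneg (G : WDigraph V) (i j : V) : 0 ≤ G.adjMatrix i j := by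
  by_cases h : G.Adj i j
  · simpa [adjMatrix, h] using (G.w_pos i j h).le
  · simp [adjMatrix, h]

theorem adjMatrix_pos (G : WDigraph V) {i j : V} (h : G.Adj i j) : 0 < G.adjMatrix i j := by
  simpa [adjMatrix, h] using G.w_pos i j h

variable [Fintype V]

/-- The (weighted) out-degree `d_i = ∑ j, A i j`. -/
noncomputable def outDegree (G : WDigraph V) (i : V) : ℝ := ∑ j, G.adjMatrix i j

theorem outDegree_nonneg (G : WDigraph V) (i : V) : 0 ≤ G.outDegree i :=
  Finset.sum_nonneg fun j _ => G.adjMatrix_nonneg i j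

theorem outDegree_pos (G : WDigraph V) {i j : V} (h : G.Adj i j) : 0 < G.outDegree i :=
  Finset.sum_pos' (fun k _ => G.adjMatrix_nonneg i k) ⟨j, Finset.mem_univ j, G.adjMatrix_pos h⟩

/-- The reweighted graph `G_r`: the same nodes and edges, with
`w_r(i, j) = w(i, j) / (α / (1 - α) * d_i)`. -/
noncomputable def reweight (G : WDigraph V) (α : ℝ) (h0 : 0 < α) (h1 : α < 1) : WDigraph V where
  Adj := G.Adj
  w i j := G.w i j / (α / (1 - α) * G.outDegree i)
  w_pos i j h := div_pos (G.w_pos i j h)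
    (mul_pos (div_pos h0 (sub_pos.2 h1)) (G.outDegree_pos h))

section PageRank

variable [DecidableEq V]

/-- The transition matrix `P = D⁻¹ A`. -/
noncomputable def transMatrix (G : WDigraph V) : Matrix V V ℝ :=
  (Matrix.diagonal G.outDegree)⁻¹ * G.adjMatrix

/-- The matrix `Π = α (I - (1 - α) P)⁻¹`, whose `i`-th row is the personalized PageRank vector of
the node `i` with restart probability `α`. -/
noncomputable def pprMatrix (G : WDigraph V) (α : ℝ) : Matrix V V ℝ :=
  α • (1 - (1 - α) • G.transMatrix)⁻¹

/-- `σ = (1 / n) 1ᵀ Π`. -/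
noncomputable def sigma (G : WDigraph V) (α : ℝ) : V → ℝ :=
  (1 / (Fintype.card V : ℝ)) • Matrix.vecMul (fun _ => 1) (G.pprMatrix α)

/-- `σ̃ = e_vᵀ Π`. -/
noncomputable def sigmaTilde (G : WDigraph V) (α : ℝ) (v : V) : V → ℝ :=
  Matrix.vecMul (Pi.single v 1) (G.pprMatrix α)

/-- `η = Π 1_S`. -/
noncomputable def eta (G : WDigraph V) (α : ℝ) (S : Finset V) : V → ℝ :=
  Matrix.mulVec (G.pprMatrix α) (fun u => if u ∈ S then 1 else 0)

end PageRank

end WDigraph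

/-- A spanning rooted forest of a digraph: a set of edges without cycles in which every node has at
most one outgoing edge. Every tree is oriented towards its root, which is its only node without an
outgoing edge. -/
@[ext]
structure SpanningRootedForest {V : Type*} (G : WDigraph V) where
  edges : Finset (V × V)
  edges_sub : ∀ i j, (i, j) ∈ edges → G.Adj i j
  out_unique : ∀ i j k, (i, j) ∈ edges → (i, k) ∈ edges → j = k
  acyclic : ∀ i, ¬ Relation.TransGen (fun a b => (a, b) ∈ edges) i i

namespace SpanningRootedForest

variable {V : Type*} {G : WDigraph V}

instance : MeasurableSpace (SpanningRootedForest G) := ⊤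

noncomputable instance [Fintype V] : Fintype (SpanningRootedForest G) :=
  Fintype.ofInjective (fun F => F.edges) fun _ _ h => SpanningRootedForest.ext h

/-- The weight `ε(F)` of a forest: the product of the weights of its edges. -/
noncomputable def weight (F : SpanningRootedForest G) : ℝ := ∏ e ∈ F.edges, G.w e.1 e.2

/-- The root set `ρ(F)`. -/
def roots (F : SpanningRootedForest G) : Set V := {i | ∀ j, (i, j) ∉ F.edges}

theorem exists_root [Finite V] (F : SpanningRootedForest G) (u : V) :
    ∃ r ∈ F.roots, Relation.ReflTransGen (fun a b => (a, b) ∈ F.edges) u r := by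
  let R : V → V → Prop := fun a b => Relation.TransGen (fun a b => (a, b) ∈ F.edges) b a
  have hT : IsTrans V R := ⟨fun _ _ _ h1 h2 => Relation.TransGen.trans h2 h1⟩
  have hI : Std.Irrefl R := ⟨F.acyclic⟩
  have hwf : WellFounded R := Finite.wellFounded_of_trans_of_irrefl R
  induction u using hwf.induction with
  | _ u ih =>
    by_cases h : u ∈ F.roots
    · exact ⟨u, h, Relation.ReflTransGen.refl⟩
    · obtain ⟨j, hj⟩ : ∃ j, (u, j) ∈ F.edges := by simpa [roots] using h
      obtain ⟨r, hr, hjr⟩ := ih j (Relation.TransGen.single hj)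
      exact ⟨r, hr, Relation.ReflTransGen.head hj hjr⟩

/-- `r(F, u)`, the root of the tree of `F` that contains `u`: the node of `ρ(F)` to which the edges
of `F` lead from `u` (it is unique, as no node has two outgoing edges). -/
noncomputable def root [Finite V] (F : SpanningRootedForest G) (u : V) : V :=
  (F.exists_root u).choose

/-- `M(F, s)`, the set of the nodes that are rooted at `s`. -/
noncomputable def rootedAt [Fintype V] [DecidableEq V] (F : SpanningRootedForest G) (s : V) :
    Finset V :=
  {u | F.root u = s}

end SpanningRootedForest

/-! The randomized algorithm RandomForest, as a machine that makes one random step at a time. -/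

namespace RandomForest

/-- The place in the program: the head of the outer loop; the first inner loop (the random walk
that started in `i` is now in `u`); the second inner loop (`u` is the next node of the retraced
branch, whose root is `r`). -/
inductive Control (V : Type*)
  | head
  | walk (i u : V)
  | retrace (r : Option V) (u : V)

/-- The memory of the program. `none` stands for the initial values of the two arrays `next` and
`root`; `todo` lists the nodes that the outer loop has still to run through. -/
structure State (V : Type*) where
  inForest : V → Bool
  next : V → Option V
  root : V → Option V
  todo : List V
  control : Control V

variable {V : Type*}

/-- The initial state, for the outer loop running through the nodes in the given order. -/
def init (order : List V) : State V where
  inForest _ := false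
  next _ := none
  root _ := none
  todo := order
  control := .head

/-- The program has ended. -/
def State.Halted (st : State V) : Prop := st.control = .head ∧ st.todo = []

variable [Fintype V]

/-- The random choice made in `u`: `none` (the node `u` becomes a root) with probability
`1 / (1 + d_u)`, and otherwise a random out-neighbour, `x` being chosen with the conditional
probability `w(u, x) / d_u`, so with probability `w(u, x) / (1 + d_u)` altogether. -/
noncomputable def choice (G : WDigraph V) (u : V) : PMF (Option V) :=
  PMF.ofFintype
    (fun o => ENNReal.ofReal (o.elim 1 (fun x => G.adjMatrix u x) / (1 + G.outDegree u))) (by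
      have hd := G.outDegree_nonneg u
      rw [← ENNReal.ofReal_sum_of_nonneg]
      · rw [← Finset.sum_div, Fintype.sum_option]
        simp only [Option.elim]
        change ENNReal.ofReal ((1 + G.outDegree u) / (1 + G.outDegree u)) = 1
        rw [div_self (by positivity), ENNReal.ofReal_one]
      · intro o _
        refine div_nonneg ?_ (by positivity)
        cases o with
        | none => simp
        | some x => simpa using G.adjMatrix_nonneg u x)

variable [DecidableEq V]

/-- One step of the program; a state in which the program has ended does not change any more. -/
noncomputable def step (G : WDigraph V) (st : State V) : PMF (State V) :=
  match st.control with
  | .head =>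
    match st.todo with
    | [] => PMF.pure st
    | i :: rest => PMF.pure { st with todo := rest, control := .walk i i }
  | .walk i u =>
    if st.inForest u then
      PMF.pure { st with control := .retrace (st.root u) i }
    else
      (choice G u).map fun o =>
        match o with
        | none =>
          { st with
            inForest := Function.update st.inForest u true
            root := Function.update st.root u (some u)
            next := Function.update st.next u none }
        | some x =>
          { st with
            next := Function.update st.next u (some x)
            control := .walk i x }
  | .retrace r u =>
    if st.inForest u then
      PMF.pure { st with control := .head }
    else
      PMF.pure
        { st with
          inForest := Function.update st.inForest u true
          root := Function.update st.root u r
          control :=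
            -- on a retraced branch `next u` is never `none`
            match st.next u with
            | none => .head
            | some x => .retrace r x }

/-- The law of the state after `t` steps. -/
noncomputable def run (G : WDigraph V) (order : List V) (t : ℕ) : PMF (State V) :=
  (fun p => p.bind (step G))^[t] (PMF.pure (init order))

/-- The final state `st` represents the forest `F`: the edges of `F` are the pairs
`(u, Next[u])`, and `Root[u] = r(F, u)` for all `u`. -/
def Represents {G : WDigraph V} (st : State V) (F : SpanningRootedForest G) : Prop :=
  (∀ u x, (u, x) ∈ F.edges ↔ st.next u = some x) ∧ ∀ u, st.root u = some (F.root u)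

/-- The probability that the program ends and returns the forest `F`. (The probability of having
done so within `t` steps increases with `t`.) -/
noncomputable def prob (G : WDigraph V) (order : List V) (F : SpanningRootedForest G) : ENNReal :=
  ⨆ t : ℕ, (run G order t).toOuterMeasure {st | st.Halted ∧ Represents st F}

end RandomForest

/-! ### Killed walks: Green functions, determinants and loop erasure -/

namespace LoopErasedWalk

variable {V : Type*} [Fintype V] [DecidableEq V]

/-! RandomForest is Wilson's algorithm for a walk that is killed in `u` with probability `1 / (1 +
d_u)`. Its law comes from an explicit harmonic function. Fix an acyclic pointer function `f`. Given
correct pointers on a finished set `A`, the chance that the others become those of `f` is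
`completion`, a product of step probabilities over a determinant. Cramer's rule (`green_self`) makes
quotients of these determinants Green functions, so `completion_eq` can fix the pointer of any
further node. During a walk, `walkValue` peels the first node `u` off the current path: either the
walk returns to `u`, which erases the whole loop, or `u` keeps its pointer and acts as a sink.
`walkValue_eq` is the harmonicity of this recursion, and `Inv.step` carries it over to the program.

A potential that falls by at least one per step in expectation gives termination
(`mul_probIn_not_halted_le`). A bounded harmonic function with the right values at halted states is
then the limiting probability of the outcome (`Inv.abs_value_sub_probIn_le`). Its initial value is
the weight of the forest times a constant, and the constant follows from the total mass being one
(`completion_pointer_eq_div`), without any evaluation of a determinant.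

For PageRank, exchanging the pointer of `u` is a weight-preserving involution (`sum_redirect`). It
yields a linear system for the total weights of the forests in which `u` is rooted at `s`; for `G_r`
the system says that these weights, normalized, invert `I - (1 - α) P` (`pprMatrix_apply`). Each of
the three estimators is thus the mean of a `[0, 1]`-valued function of the forest with the desired
expectation, and Hoeffding's inequality applies. -/

/-- The matrix `I - p` of a killed walk, with the rows in `A` replaced by those of the identity:
the walk is stopped in `A`. -/
noncomputable def sinkMatrix (p : V → Option V → ℝ) (A : Finset V) : Matrix V V ℝ :=
  Matrix.of fun i j =>
    if i ∈ A then (1 : Matrix V V ℝ) i j else (1 : Matrix V V ℝ) i j - p i (some j)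

/-- A walk that steps from `u` to `x` with probability `p u (some x)` and is killed in `u` with
the positive probability `p u none`. -/
structure IsKilledWalk {V : Type*} [Fintype V] (p : V → Option V → ℝ) : Prop where
  nonneg : ∀ u o, 0 ≤ p u o
  kill_pos : ∀ u, 0 < p u none
  sum_eq_one : ∀ u, ∑ o, p u o = 1

variable {p : V → Option V → ℝ}

/-- Strict diagonal dominance: in a row outside `A` the slack is the killing probability. -/
theorem det_sinkMatrix_ne_zero (hp : IsKilledWalk p) (A : Finset V) :
    (sinkMatrix p A).det ≠ 0 := by
  apply det_ne_zero_of_sum_row_lt_diag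
  intro i
  by_cases hi : i ∈ A
  · rw [Finset.sum_eq_zero]
    · simp [sinkMatrix, hi]
    · intro j hj
      simp [sinkMatrix, hi, Matrix.one_apply_ne (Finset.ne_of_mem_erase hj).symm]
  · have h1 := hp.sum_eq_one i
    rw [Fintype.sum_option, ← Finset.add_sum_erase _ _ (Finset.mem_univ i)] at h1
    have h2 : ∑ j ∈ Finset.univ.erase i, ‖sinkMatrix p A i j‖
        = ∑ j ∈ Finset.univ.erase i, p i (some j) := by
      refine Finset.sum_congr rfl fun j hj => ?_
      simp [sinkMatrix, hi, Matrix.one_apply_ne (Finset.ne_of_mem_erase hj).symm,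
        abs_of_nonneg (hp.nonneg i (some j))]
    have h3 : sinkMatrix p A i i = 1 - p i (some i) := by simp [sinkMatrix, hi]
    rw [h2, h3]
    have := hp.kill_pos i
    refine lt_of_lt_of_le ?_ (Real.le_norm_self _)
    linarith

/-- The expected number of visits to `u` of the walk from `y` before it is stopped in `A`. -/
noncomputable def green (p : V → Option V → ℝ) (A : Finset V) (u y : V) : ℝ :=
  (sinkMatrix p A)⁻¹ y u

/-- The probability that the walk from `y` visits `u` before it is stopped in `A`. -/
noncomputable def hit (p : V → Option V → ℝ) (A : Finset V) (u y : V) : ℝ :=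
  green p A u y / green p A u u

theorem sinkMatrix_mul_green (hp : IsKilledWalk p) (A : Finset V) (u y : V) :
    ∑ z, sinkMatrix p A y z * green p A u z = (1 : Matrix V V ℝ) y u := by
  rw [← Matrix.mul_nonsing_inv (sinkMatrix p A) (det_sinkMatrix_ne_zero hp A).isUnit,
    Matrix.mul_apply]
  rfl

theorem green_of_mem (hp : IsKilledWalk p) {A : Finset V} {u y : V} (hy : y ∈ A) (hu : u ∉ A) :
    green p A u y = 0 := by
  have h := sinkMatrix_mul_green hp A u y
  have hne : y ≠ u := fun h => hu (h ▸ hy)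
  simpa [sinkMatrix, hy, Matrix.one_apply, hne] using h

theorem green_of_notMem (hp : IsKilledWalk p) {A : Finset V} {y : V} (u : V) (hy : y ∉ A) :
    green p A u y = ∑ z, p y (some z) * green p A u z + if y = u then 1 else 0 := by
  have h := sinkMatrix_mul_green hp A u y
  simp only [sinkMatrix, hy, Matrix.of_apply, if_false, sub_mul, Finset.sum_sub_distrib,
    Matrix.one_apply, ite_mul, one_mul, zero_mul, Finset.sum_ite_eq, Finset.mem_univ,
    if_true] at h
  linarith

/-- Cramer's rule: making `u` a sink replaces its row by a unit vector, so the new determinant is a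
diagonal entry of the adjugate. -/
theorem green_self (hp : IsKilledWalk p) {A : Finset V} {u : V} (hu : u ∉ A) :
    green p A u u * (sinkMatrix p A).det = (sinkMatrix p (insert u A)).det := by
  have hd := det_sinkMatrix_ne_zero hp A
  have h : sinkMatrix p (insert u A) = (sinkMatrix p A).updateRow u (Pi.single u 1) := by
    ext i j
    by_cases hi : i = u
    · subst hi
      simp [sinkMatrix, Matrix.one_apply, Pi.single_apply, eq_comm]
    · simp [sinkMatrix, hi]
  rw [h, ← Matrix.adjugate_apply, green, Matrix.inv_def, Matrix.smul_apply, smul_eq_mul,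
    Ring.inverse_eq_inv']
  field_simp

theorem green_self_ne_zero (hp : IsKilledWalk p) {A : Finset V} {u : V} (hu : u ∉ A) :
    green p A u u ≠ 0 := by
  intro h
  have := green_self hp hu
  rw [h, zero_mul] at this
  exact det_sinkMatrix_ne_zero hp _ this.symm

theorem hit_self (hp : IsKilledWalk p) {A : Finset V} {u : V} (hu : u ∉ A) :
    hit p A u u = 1 := div_self (green_self_ne_zero hp hu)

theorem hit_of_mem (hp : IsKilledWalk p) {A : Finset V} {u y : V} (hy : y ∈ A) (hu : u ∉ A) :
    hit p A u y = 0 := by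
  rw [hit, green_of_mem hp hy hu, zero_div]

theorem hit_of_notMem (hp : IsKilledWalk p) {A : Finset V} {u y : V} (hy : y ∉ A)
    (hyu : y ≠ u) : hit p A u y = ∑ z, p y (some z) * hit p A u z := by
  simp only [hit]
  rw [green_of_notMem hp u hy]
  simp [hyu, Finset.sum_div, mul_div_assoc]

/-- The left side is the return probability of `u`; visits form a geometric sequence, so `1 / green
p A u u` is the probability of no return. -/
theorem sum_mul_hit (hp : IsKilledWalk p) {A : Finset V} {u : V} (hu : u ∉ A) :
    ∑ z, p u (some z) * hit p A u z = 1 - 1 / green p A u u := by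
  have h0 := green_self_ne_zero hp hu
  have h := green_of_notMem hp u hu
  simp only [if_true] at h
  have h1 : ∑ z, p u (some z) * hit p A u z
      = (∑ z, p u (some z) * green p A u z) / green p A u u := by
    simp only [hit, Finset.sum_div, mul_div_assoc]
  rw [h1, eq_sub_of_add_eq h.symm, sub_div, div_self h0]

/-- The probability that the pointers outside `A` become those of `f`, given that those in `A`
are fixed already. -/
noncomputable def completion (p : V → Option V → ℝ) (f : V → Option V) (A : Finset V) : ℝ :=
  (∏ u ∈ Aᶜ, p u (f u)) / (sinkMatrix p A).det

/-- The determinants telescope by `green_self`. Since `u` is an arbitrary node outside `A`, the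
order in which nodes are treated cannot matter. -/
theorem completion_eq (hp : IsKilledWalk p) (f : V → Option V) {A : Finset V} {u : V}
    (hu : u ∉ A) :
    completion p f A = green p A u u * (p u (f u) * completion p f (insert u A)) := by
  have hd := det_sinkMatrix_ne_zero hp A
  have hd' := det_sinkMatrix_ne_zero hp (insert u A)
  have h : ∏ x ∈ Aᶜ, p x (f x) = p u (f u) * ∏ x ∈ (insert u A)ᶜ, p x (f x) := by
    rw [Finset.compl_insert,
      Finset.mul_prod_erase _ (fun x => p x (f x)) (Finset.mem_compl.2 hu)]
  rw [completion, completion, h, ← green_self hp hu]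
  have h0 := green_self_ne_zero hp hu
  field_simp

theorem completion_univ (f : V → Option V) : completion p f Finset.univ = 1 := by
  have : sinkMatrix p Finset.univ = 1 := by ext i j; simp [sinkMatrix]
  simp [completion, this]

/-- The probability that the pointers outside `A` become those of `f` when the loop-erased walk
has run through the nodes of the list and is now in `y`. -/
noncomputable def walkValue (p : V → Option V → ℝ) (f : V → Option V) :
    Finset V → List V → V → ℝ
  | A, [], _ => completion p f A
  | A, u :: l, y => hit p A u y * completion p f A +
      if f u = (l ++ [y]).head? then walkValue p f (insert u A) l y else 0

theorem isChain_cons_append {V : Type*} {next : V → Option V} {u y : V} {l : List V} :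
    List.IsChain (fun a b => next a = some b) (u :: l ++ [y]) ↔
      next u = (l ++ [y]).head? ∧ List.IsChain (fun a b => next a = some b) (l ++ [y]) := by
  cases l <;> simp

/-- A walk standing in a sink hits nothing more, so every `hit` term of the recursion vanishes and
only the comparison of the path with `f` is left. -/
theorem walkValue_of_mem (hp : IsKilledWalk p) (f : V → Option V) {A : Finset V} {l : List V}
    {y : V} (hy : y ∈ A) (hl : l.Nodup) (hA : ∀ u ∈ l, u ∉ A) :
    (List.IsChain (fun a b => f a = some b) (l ++ [y]) →
      walkValue p f A l y = completion p f (A ∪ l.toFinset)) ∧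
    (¬ List.IsChain (fun a b => f a = some b) (l ++ [y]) → walkValue p f A l y = 0) := by
  induction l generalizing A with
  | nil => simp [walkValue]
  | cons u l ih =>
    have hu : u ∉ A := hA u (by simp)
    rw [List.nodup_cons] at hl
    have := ih (A := insert u A) (by simp [hy]) hl.2 (fun v hv => by
      rw [Finset.mem_insert, not_or]
      exact ⟨fun h => hl.1 (h ▸ hv), hA v (by simp [hv])⟩)
    have hU : insert u A ∪ l.toFinset = A ∪ (u :: l).toFinset := by
      ext; simp
    rw [hU] at this
    rw [isChain_cons_append, walkValue, hit_of_mem hp hy hu, zero_mul, zero_add]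
    constructor
    · rintro ⟨h1, h2⟩
      rw [if_pos h1, this.1 h2]
    · intro h
      split_ifs with h1
      · exact this.2 fun h2 => h ⟨h1, h2⟩
      · rfl

/-- Loop erasure never changes the starting node of the path. -/
theorem takeWhile_ne_append_head? {V : Type*} [DecidableEq V] (l : List V) (y z : V) :
    ((l ++ [y]).takeWhile (fun x => decide (x ≠ z)) ++ [z]).head? = (l ++ [y]).head? := by
  cases l with
  | nil => by_cases h : y = z <;> simp [h]
  | cons a l => by_cases h : a = z <;> simp [h]

theorem not_isChain_of_acyclic {V : Type*} {r : V → V → Prop} (hr : ∀ v, ¬ Relation.TransGen r v v)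
    (u : V) (l : List V) : ¬ List.IsChain r (u :: l ++ [u]) := by
  intro h
  have key : ∀ (l : List V) (a b : V), List.IsChain r (a :: l ++ [b]) →
      Relation.TransGen r a b := by
    intro l
    induction l with
    | nil => intro a b h; simpa using Relation.TransGen.single (by simpa using h)
    | cons c l ih =>
      intro a b h
      simp only [List.cons_append, List.isChain_cons_cons] at h
      exact Relation.TransGen.head h.1 (ih c b h.2)
  exact hr u (key l u u h)

/-- The walk value is harmonic for the loop-erased walk. -/
theorem walkValue_eq (hp : IsKilledWalk p) {f : V → Option V}
    (hf : ∀ v, ¬ Relation.TransGen (fun a b => f a = some b) v v)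
    {A : Finset V} {l : List V} {y : V} (hl : (l ++ [y]).Nodup) (hA : ∀ u ∈ l ++ [y], u ∉ A) :
    walkValue p f A l y =
      p y none * (if f y = none then walkValue p f (insert y A) l y else 0) +
      ∑ z, p y (some z) *
        walkValue p f A ((l ++ [y]).takeWhile (fun x => decide (x ≠ z))) z := by
  induction l generalizing A with
  | nil =>
    have hy : y ∉ A := hA y (by simp)
    -- Without a loop of `f` at `y`, the formula `h1` also covers the step `z = y`, which erases the
    -- whole path.
    have hfy : f y ≠ some y := fun h => hf y (Relation.TransGen.single h)
    have h1 : ∀ z, walkValue p f A (([] ++ [y]).takeWhile (fun x => decide (x ≠ z))) z =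
        hit p A y z * completion p f A +
          if f y = some z then completion p f (insert y A) else 0 := by
      intro z
      by_cases h : y = z
      · subst h
        simp [walkValue, hfy, hit_self hp hy]
      · simp only [List.nil_append, ne_eq, h, not_false_eq_true, decide_true,
          List.takeWhile_cons_of_pos, List.takeWhile_nil, walkValue, List.head?_cons]
        congr
    simp only [h1]
    simp only [walkValue, mul_add, Finset.sum_add_distrib, ← mul_assoc]
    rw [← Finset.sum_mul, sum_mul_hit hp hy]
    have h2 : p y none * (if f y = none then completion p f (insert y A) else 0) +
        ∑ z, p y (some z) * (if f y = some z then completion p f (insert y A) else 0) =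
        p y (f y) * completion p f (insert y A) := by
      cases h : f y with
      | none => simp
      | some x => simp
    have h3 := completion_eq hp f hy
    have h0 := green_self_ne_zero hp hy
    -- The returning walks account for the share `1 - 1 / green p A y y` of `completion p f A`; the
    -- final choice made in `y` has to supply the rest.
    have h4 : 1 / green p A y y * completion p f A = p y (f y) * completion p f (insert y A) := by
      rw [h3]; field_simp
    linear_combination h4 - h2
  | cons u l ih =>
    have hu : u ∉ A := hA u (by simp)
    have hy : y ∉ A := hA y (by simp)
    rw [List.cons_append, List.nodup_cons] at hl
    have hyu : y ≠ u := fun h => hl.1 (by simp [h])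
    have hlA : ∀ v ∈ l ++ [y], v ∉ insert u A := fun v hv => by
      rw [Finset.mem_insert, not_or]
      exact ⟨fun h => hl.1 (h ▸ hv),
        hA v (by simp only [List.cons_append, List.mem_cons, hv, or_true])⟩
    have ih' := ih (A := insert u A) hl.2 hlA
    -- The recursion opens at `u` in the same form for every `z`. For `z = u` the first factor is
    -- one and the second term vanishes, because the path closed at `u` would be a cycle of `f`.
    have hz : ∀ z, walkValue p f A ((u :: l ++ [y]).takeWhile (fun x => decide (x ≠ z))) z =
        hit p A u z * completion p f A +
          if f u = (l ++ [y]).head? then walkValue p f (insert u A)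
            ((l ++ [y]).takeWhile (fun x => decide (x ≠ z))) z else 0 := by
      intro z
      by_cases h : u = z
      · subst h
        have htw : (l ++ [y]).takeWhile (fun x => decide (x ≠ u)) = l ++ [y] := by
          rw [List.takeWhile_eq_self_iff]
          intro x hx
          have : x ≠ u := fun h => hl.1 (h ▸ hx)
          simpa using this
        rw [htw, hit_self hp hu, List.cons_append, List.takeWhile_cons_of_neg (by simp)]
        simp only [walkValue, one_mul]
        split_ifs with h1
        · rw [(walkValue_of_mem hp f (by simp) hl.2 hlA).2]
          · simp
          · intro hc
            apply not_isChain_of_acyclic hf u (l ++ [y])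
            rw [List.cons_append]
            cases l with
            | nil => simpa using ⟨by simpa using h1, by simpa using hc⟩
            | cons a l =>
              simp only [List.cons_append, List.isChain_cons_cons]
              exact ⟨by simpa using h1, by simpa using hc⟩
        · simp
      · rw [← takeWhile_ne_append_head? l y z]
        simp only [List.cons_append, List.takeWhile_cons, h, ne_eq, not_false_eq_true, decide_true,
          if_true, walkValue]
    simp only [hz]
    -- Killed in `y`, the walk can no longer hit `u`.
    have h5 : walkValue p f (insert y A) (u :: l) y =
        if f u = (l ++ [y]).head? then walkValue p f (insert y (insert u A)) l y else 0 := by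
      rw [walkValue, hit_of_mem hp (by simp) (by simp [hu, hyu.symm]), zero_mul, zero_add,
        Finset.insert_comm]
    rw [h5, walkValue, hit_of_notMem hp hy hyu, Finset.sum_mul]
    simp only [mul_add, Finset.sum_add_distrib, ← mul_assoc]
    by_cases h1 : f u = (l ++ [y]).head?
    · simp only [if_pos h1]
      rw [ih']
      ring
    · simp only [if_neg h1, ite_self, mul_zero, Finset.sum_const_zero, zero_add, add_zero]

/-- The walk values of the loop-erased paths are bounded. -/
theorem exists_abs_walkValue_le (p : V → Option V → ℝ) (f : V → Option V) :
    ∃ C, ∀ A l y, l.Nodup → |walkValue p f A l y| ≤ C := by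
  let K : ℝ := ∑ A : Finset V, (|completion p f A| + ∑ u, ∑ y, |hit p A u y * completion p f A|)
  have hK1 : ∀ A, |completion p f A| + ∑ u, ∑ y, |hit p A u y * completion p f A| ≤ K := fun A =>
    Finset.single_le_sum (f := fun A : Finset V => |completion p f A| +
      ∑ u, ∑ y, |hit p A u y * completion p f A|) (fun A _ => by positivity) (Finset.mem_univ A)
  have hc : ∀ A, |completion p f A| ≤ K := fun A =>
    le_trans (le_add_of_nonneg_right (by positivity)) (hK1 A)
  have hh : ∀ A u y, |hit p A u y * completion p f A| ≤ K := fun A u y => by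
    refine le_trans ?_ (hK1 A)
    refine le_trans ?_ (le_add_of_nonneg_left (abs_nonneg _))
    refine le_trans ?_ (Finset.single_le_sum
      (f := fun u => ∑ y, |hit p A u y * completion p f A|)
      (fun u _ => by positivity) (Finset.mem_univ u))
    exact Finset.single_le_sum (f := fun y => |hit p A u y * completion p f A|)
      (fun y _ => abs_nonneg _) (Finset.mem_univ y)
  have hK : 0 ≤ K := le_trans (abs_nonneg _) (hc ∅)
  -- Each unfolding of the recursion adds at most `K`; a path without repetitions has at most
  -- `Fintype.card V` nodes.
  have key : ∀ l A y, |walkValue p f A l y| ≤ ((l.length : ℝ) + 1) * K := by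
    intro l
    induction l with
    | nil => intro A y; simpa [walkValue] using hc A
    | cons u l ih =>
      intro A y
      rw [walkValue]
      refine (abs_add_le _ _).trans ?_
      have h2 : |if f u = (l ++ [y]).head? then walkValue p f (insert u A) l y else 0|
          ≤ ((l.length : ℝ) + 1) * K := by
        split_ifs
        · exact ih _ _
        · rw [abs_zero]; positivity
      have := hh A u y
      push_cast [List.length_cons]
      linarith
  refine ⟨((Fintype.card V : ℝ) + 1) * K, fun A l y hl => (key l A y).trans ?_⟩
  have : (l.length : ℝ) ≤ Fintype.card V := by exact_mod_cast hl.length_le_card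
  gcongr

end LoopErasedWalk

/-! ### The program as a Markov chain -/

namespace RandomForest

open LoopErasedWalk

variable {V : Type*} [Fintype V] [DecidableEq V]

/-- The probability of the outcome `o` of the random choice made in `u`. -/
noncomputable def choiceProb {V : Type*} [Fintype V] (G : WDigraph V) (u : V) (o : Option V) : ℝ :=
  o.elim 1 (fun x => G.adjMatrix u x) / (1 + G.outDegree u)

theorem one_add_outDegree_pos {V : Type*} [Fintype V] (G : WDigraph V) (u : V) :
    0 < 1 + G.outDegree u := by
  have := G.outDegree_nonneg u
  positivity

theorem isKilledWalk_choiceProb {V : Type*} [Fintype V] (G : WDigraph V) :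
    IsKilledWalk (choiceProb G) where
  nonneg u o := by
    refine div_nonneg ?_ (one_add_outDegree_pos G u).le
    cases o with
    | none => simp
    | some x => simpa using G.adjMatrix_nonneg u x
  kill_pos u := div_pos one_pos (one_add_outDegree_pos G u)
  sum_eq_one u := by
    simp only [choiceProb]
    rw [← Finset.sum_div, Fintype.sum_option]
    exact div_self (one_add_outDegree_pos G u).ne'

theorem choice_apply {V : Type*} [Fintype V] (G : WDigraph V) (u : V) (o : Option V) :
    (choice G u o).toReal = choiceProb G u o :=
  ENNReal.toReal_ofReal ((isKilledWalk_choiceProb G).nonneg u o)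

/-- The law of the state `t` steps after the state `st`. -/
noncomputable def runFrom (G : WDigraph V) (t : ℕ) (st : State V) : PMF (State V) :=
  (fun p => p.bind (step G))^[t] (PMF.pure st)

/-- Linearity in the initial law. It turns the iteration, which appends a last step, into first-step
analysis (`runFrom_succ`). -/
theorem iterate_bind (G : WDigraph V) (t : ℕ) (q : PMF (State V)) :
    (fun p => p.bind (step G))^[t] q = q.bind (runFrom G t) := by
  induction t with
  | zero => exact q.bind_pure.symm
  | succ t ih =>
    have h : runFrom G (t + 1) = fun st => (runFrom G t st).bind (step G) :=
      funext fun st => Function.iterate_succ_apply' _ _ _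
    rw [Function.iterate_succ_apply', ih, PMF.bind_bind, h]

theorem runFrom_succ (G : WDigraph V) (t : ℕ) (st : State V) :
    runFrom G (t + 1) st = (step G st).bind (runFrom G t) := by
  rw [runFrom, Function.iterate_succ_apply, iterate_bind, PMF.pure_bind]

/-- The probability of being in `S` after `t` steps from `st`. -/
noncomputable def probIn (G : WDigraph V) (S : Set (State V)) (t : ℕ) (st : State V) : ℝ :=
  ((runFrom G t st).toOuterMeasure S).toReal

theorem toOuterMeasure_ne_top {σ : Type*} (q : PMF σ) (S : Set σ) : q.toOuterMeasure S ≠ ⊤ := by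
  refine ne_top_of_le_ne_top ENNReal.one_ne_top ?_
  rw [← (q.toOuterMeasure_apply_eq_one_iff (s := Set.univ)).2 (Set.subset_univ _)]
  exact measure_mono (Set.subset_univ S)

theorem probIn_nonneg (G : WDigraph V) (S : Set (State V)) (t : ℕ) (st : State V) :
    0 ≤ probIn G S t st := ENNReal.toReal_nonneg

open Classical in
theorem probIn_zero (G : WDigraph V) (S : Set (State V)) (st : State V) :
    probIn G S 0 st = if st ∈ S then 1 else 0 := by
  simp only [probIn, runFrom, Function.iterate_zero, id, PMF.toOuterMeasure_pure_apply]
  split_ifs <;> simp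

theorem probIn_succ_of_pure {G : WDigraph V} {st st' : State V} (h : step G st = PMF.pure st')
    (S : Set (State V)) (t : ℕ) : probIn G S (t + 1) st = probIn G S t st' := by
  rw [probIn, runFrom_succ, h, PMF.pure_bind, probIn]

theorem probIn_succ_of_map {G : WDigraph V} {st : State V} {u : V} {k : Option V → State V}
    (h : step G st = (choice G u).map k) (S : Set (State V)) (t : ℕ) :
    probIn G S (t + 1) st = ∑ o, choiceProb G u o * probIn G S t (k o) := by
  rw [probIn, runFrom_succ, h, PMF.bind_map, PMF.toOuterMeasure_bind_apply, tsum_fintype,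
    ENNReal.toReal_sum]
  · refine Finset.sum_congr rfl fun o _ => ?_
    rw [ENNReal.toReal_mul, choice_apply]
    rfl
  · exact fun o _ => ENNReal.mul_ne_top (PMF.apply_ne_top _ _) (toOuterMeasure_ne_top _ _)

/-- The state after the random choice `o` made in `u`, on the walk that started in `i`. -/
def walkStep (st : State V) (i u : V) : Option V → State V
  | none =>
    { st with
      inForest := Function.update st.inForest u true
      root := Function.update st.root u (some u)
      next := Function.update st.next u none }
  | some x =>
    { st with
      next := Function.update st.next u (some x)
      control := .walk i x }

theorem step_halted {G : WDigraph V} {st : State V} (h : st.Halted) :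
    step G st = PMF.pure st := by
  simp [step, h.1, h.2]

theorem step_head {G : WDigraph V} {st : State V} {i : V} {rest : List V}
    (hc : st.control = .head) (ht : st.todo = i :: rest) :
    step G st = PMF.pure { st with todo := rest, control := .walk i i } := by
  simp [step, hc, ht]

theorem step_walk_of_inForest {G : WDigraph V} {st : State V} {i u : V}
    (hc : st.control = .walk i u) (hu : st.inForest u = true) :
    step G st = PMF.pure { st with control := .retrace (st.root u) i } := by
  simp [step, hc, hu]

theorem step_walk {G : WDigraph V} {st : State V} {i u : V}
    (hc : st.control = .walk i u) (hu : st.inForest u = false) :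
    step G st = (choice G u).map (walkStep st i u) := by
  simp only [step, hc, hu, Bool.false_eq_true, if_false]
  congr 1
  funext o
  cases o <;> simp [walkStep, hc]

theorem step_retrace_of_inForest {G : WDigraph V} {st : State V} {r : Option V} {u : V}
    (hc : st.control = .retrace r u) (hu : st.inForest u = true) :
    step G st = PMF.pure { st with control := .head } := by
  simp [step, hc, hu]

theorem step_retrace {G : WDigraph V} {st : State V} {r : Option V} {u : V}
    (hc : st.control = .retrace r u) (hu : st.inForest u = false) :
    step G st = PMF.pure
      { st with
        inForest := Function.update st.inForest u true
        root := Function.update st.root u r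
        control :=
          match st.next u with
          | none => .head
          | some x => .retrace r x } := by
  cases hn : st.next u <;> simp [step, hc, hu, hn]

/-! ### Termination -/

/-- The set of the finished nodes. -/
def finished {V : Type*} [Fintype V] (st : State V) : Finset V := {u | st.inForest u = true}

theorem mem_finished {V : Type*} [Fintype V] {st : State V} {u : V} :
    u ∈ finished st ↔ st.inForest u = true := by
  simp [finished]

theorem notMem_finished {V : Type*} [Fintype V] {st : State V} {u : V} :
    u ∉ finished st ↔ st.inForest u = false := by
  simp [finished]

theorem finished_update {st st' : State V} {u : V}
    (h : st'.inForest = Function.update st.inForest u true) :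
    finished st' = insert u (finished st) := by
  ext v
  by_cases hv : v = u <;> simp [mem_finished, h, hv]

/-- An upper bound for the cost of the part of the program that is being executed. -/
def controlCost : Control V → ℝ
  | .head => 0
  | .walk _ _ => 2
  | .retrace _ _ => 1

/-- An upper bound for the expected number of steps from a state to the end of the program. -/
noncomputable def potential (G : WDigraph V) (st : State V) : ℝ :=
  (1 + ∑ u, G.outDegree u) * ((finished st)ᶜ.card : ℝ) + 3 * (st.todo.length : ℝ) +
    controlCost st.control

theorem potential_nonneg (G : WDigraph V) (st : State V) : 0 ≤ potential G st := by
  have h1 : 0 ≤ ∑ u, G.outDegree u := Finset.sum_nonneg fun u _ => G.outDegree_nonneg u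
  have h2 : 0 ≤ controlCost st.control := by cases st.control <;> simp [controlCost]
  unfold potential
  positivity

theorem card_compl_insert {S : Finset V} {u : V} (hu : u ∉ S) :
    ((Sᶜ.card : ℕ) : ℝ) = ((insert u S)ᶜ.card : ℝ) + 1 := by
  rw [Finset.compl_insert, ← Finset.card_erase_add_one (Finset.mem_compl.2 hu)]
  push_cast
  rfl

/-- First-step analysis: until the program halts, the potential drops by at least one per step in
expectation. The 3 per listed node pays for starting the walk, starting the retracing and returning
to the head. -/
theorem mul_probIn_not_halted_le (G : WDigraph V) (t : ℕ) (st : State V) :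
    (t : ℝ) * probIn G {st | ¬ st.Halted} t st ≤ potential G st := by
  have hone : ∀ (t : ℕ) (st : State V), probIn G {st | ¬ st.Halted} t st ≤ 1 := by
    intro t st
    rw [probIn, ← ENNReal.toReal_one]
    refine ENNReal.toReal_mono ENNReal.one_ne_top ?_
    rw [← ((runFrom G t st).toOuterMeasure_apply_eq_one_iff (s := Set.univ)).2
      (Set.subset_univ _)]
    exact measure_mono (Set.subset_univ _)
  have hsum : 0 ≤ ∑ u, G.outDegree u := Finset.sum_nonneg fun u _ => G.outDegree_nonneg u
  induction t generalizing st with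
  | zero => simpa using potential_nonneg G st
  | succ t ih =>
    have hpure : ∀ st', step G st = PMF.pure st' → potential G st' + 1 ≤ potential G st →
        ((t + 1 : ℕ) : ℝ) * probIn G {st | ¬ st.Halted} (t + 1) st ≤ potential G st := by
      intro st' h hle
      rw [probIn_succ_of_pure h]
      push_cast
      linarith [ih st', hone t st']
    by_cases hH : st.Halted
    · have hz : ∀ t, probIn G {st | ¬ st.Halted} t st = 0 := by
        intro t
        induction t with
        | zero => simp [probIn_zero, hH]
        | succ t iht => rw [probIn_succ_of_pure (step_halted hH), iht]
      rw [hz, mul_zero]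
      exact potential_nonneg G st
    · cases hc : st.control with
      | head =>
        cases ht : st.todo with
        | nil => exact absurd ⟨hc, ht⟩ hH
        | cons i rest =>
          refine hpure _ (step_head hc ht) ?_
          have : finished { st with todo := rest, control := .walk i i } = finished st := rfl
          simp only [potential, this, hc, ht, controlCost, List.length_cons]
          push_cast
          linarith
      | walk i u =>
        cases hu : st.inForest u with
        | true =>
          refine hpure _ (step_walk_of_inForest hc hu) ?_
          have : finished { st with control := .retrace (st.root u) i } = finished st := rfl
          simp only [potential, this, hc, controlCost]
          linarith
        | false =>
          have hu' := notMem_finished.2 hu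
          rw [probIn_succ_of_map (step_walk hc hu), Finset.mul_sum]
          have hs := (isKilledWalk_choiceProb G).sum_eq_one u
          have hnone : potential G (walkStep st i u none) =
              potential G st - (1 + ∑ u, G.outDegree u) := by
            have hf : finished (walkStep st i u none) = insert u (finished st) :=
              finished_update rfl
            rw [potential, potential, hf, card_compl_insert hu']
            simp only [walkStep]
            ring
          have hsome : ∀ x, potential G (walkStep st i u (some x)) = potential G st := by
            intro x
            have hf : finished (walkStep st i u (some x)) = finished st := rfl
            rw [potential, potential, hf, hc]
            simp [walkStep, controlCost]
          -- The factor `1 + ∑ u, G.outDegree u` per unfinished node is chosen for this: it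
          -- outweighs the killing probability `1 / (1 + d_u)` at every `u`.
          have hkill : 1 ≤ choiceProb G u none * (1 + ∑ u, G.outDegree u) := by
            have h1 : G.outDegree u ≤ ∑ u, G.outDegree u :=
              Finset.single_le_sum (fun u _ => G.outDegree_nonneg u) (Finset.mem_univ u)
            have h2 := one_add_outDegree_pos G u
            simp only [choiceProb, Option.elim]
            rw [one_div_mul_eq_div, le_div_iff₀ h2]
            linarith
          have hle : ∀ o, ((t + 1 : ℕ) : ℝ) *
              (choiceProb G u o * probIn G {st | ¬ st.Halted} t (walkStep st i u o)) ≤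
              choiceProb G u o * (potential G (walkStep st i u o) + 1) := by
            intro o
            have h1 := ih (walkStep st i u o)
            have h2 := hone t (walkStep st i u o)
            have h3 := (isKilledWalk_choiceProb G).nonneg u o
            rw [mul_left_comm]
            push_cast
            exact mul_le_mul_of_nonneg_left (by linarith) h3
          refine (Finset.sum_le_sum fun o _ => hle o).trans ?_
          rw [Fintype.sum_option] at hs ⊢
          simp only [hsome, hnone]
          rw [← Finset.sum_mul, eq_sub_of_add_eq' hs]
          linarith
      | retrace r u =>
        cases hu : st.inForest u with
        | true =>
          refine hpure _ (step_retrace_of_inForest hc hu) ?_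
          have : finished { st with control := .head } = finished st := rfl
          simp only [potential, this, hc, controlCost]
          linarith
        | false =>
          refine hpure _ (step_retrace hc hu) ?_
          rw [potential, potential, finished_update rfl, hc,
            card_compl_insert (notMem_finished.2 hu)]
          have : controlCost (match st.next u with
            | none => .head
            | some x => .retrace r x : Control V) ≤ 1 := by
            cases st.next u <;> simp [controlCost]
          simp only [controlCost] at this ⊢
          linarith

end RandomForest

/-! ### The invariant of the program and the harmonic value -/

namespace RandomForest

open LoopErasedWalk

/-- The pointers `next` lead from `v` to the node `r` without a pointer, all on `S`. -/
inductive Leads {V : Type*} (next : V → Option V) (S : Finset V) : V → V → Prop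
  | root {v : V} : v ∈ S → next v = none → Leads next S v v
  | step {v x r : V} : v ∈ S → next v = some x → Leads next S x r → Leads next S v r

theorem Leads.mono {V : Type*} {next next' : V → Option V} {S S' : Finset V} {v r : V}
    (h : Leads next S v r) (hS : S ⊆ S') (hn : ∀ v ∈ S, next' v = next v) :
    Leads next' S' v r := by
  induction h with
  | root hv h => exact .root (hS hv) ((hn _ hv).trans h)
  | step hv h _ ih => exact .step (hS hv) ((hn _ hv).trans h) ih

theorem Leads.next_eq_none {V : Type*} {next : V → Option V} {S : Finset V} {v r : V}
    (h : Leads next S v r) : next r = none := by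
  induction h with
  | root _ h => exact h
  | step _ _ _ ih => exact ih

theorem Leads.reflTransGen {V : Type*} {next : V → Option V} {S : Finset V} {v r : V}
    (h : Leads next S v r) : Relation.ReflTransGen (fun a b => next a = some b) v r := by
  induction h with
  | root _ _ => exact .refl
  | step _ h _ ih => exact .head h ih

theorem Leads.not_transGen_self {V : Type*} {next : V → Option V} {S : Finset V} {v r : V}
    (h : Leads next S v r) : ¬ Relation.TransGen (fun a b => next a = some b) v v := by
  induction h with
  | root _ h =>
    intro ht
    obtain ⟨b, hb, -⟩ := Relation.TransGen.head'_iff.1 ht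
    simp [h] at hb
  | step _ h _ ih =>
    intro ht
    obtain ⟨b, hb, hbv⟩ := Relation.TransGen.head'_iff.1 ht
    obtain rfl : _ = b := Option.some.inj (h.symm.trans hb)
    exact ih (Relation.TransGen.tail' hbv h)

/-- Along the chain `next` determines every successor, so being a chain for `f` too means agreeing
with `next` there. -/
theorem isChain_iff_of_isChain {V : Type*} {next f : V → Option V} {y : V} {l : List V}
    (h : List.IsChain (fun a b => next a = some b) (l ++ [y])) :
    List.IsChain (fun a b => f a = some b) (l ++ [y]) ↔ ∀ v ∈ l, next v = f v := by
  induction l with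
  | nil => simp
  | cons u l ih =>
    rw [isChain_cons_append] at h ⊢
    rw [ih h.2, ← h.1, List.forall_mem_cons, eq_comm]

theorem isChain_update {V : Type*} [DecidableEq V] {next : V → Option V} {y u : V} {l : List V}
    (h : List.IsChain (fun a b => next a = some b) (l ++ [y])) (hu : u ∉ l) (o : Option V) :
    List.IsChain (fun a b => Function.update next u o a = some b) (l ++ [y]) := by
  rw [isChain_iff_of_isChain h]
  intro v hv
  have hvu : v ≠ u := fun h => hu (h ▸ hv)
  rw [Function.update_of_ne hvu]

theorem Leads.of_isChain {V : Type*} {next : V → Option V} {S : Finset V} {y r : V} {l : List V}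
    (hy : Leads next S y r) (h : List.IsChain (fun a b => next a = some b) (l ++ [y]))
    (hl : ∀ v ∈ l, v ∈ S) : ∀ v ∈ l, Leads next S v r := by
  suffices ∀ v ∈ l ++ [y], Leads next S v r from fun v hv => this v (by simp [hv])
  induction l with
  | nil => simpa using hy
  | cons u l ih =>
    rw [isChain_cons_append] at h
    have ih' := ih h.2 (fun v hv => hl v (by simp [hv]))
    have hu : Leads next S u r := by
      cases l with
      | nil => exact .step (hl u (by simp)) (by simpa using h.1) hy
      | cons a l => exact .step (hl u (by simp)) (by simpa using h.1) (ih' a (by simp))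
    rw [List.cons_append, List.forall_mem_cons]
    exact ⟨hu, ih'⟩

/-- Lets the erased path inherit the chain property from the path extended by `x`, whether or not
`x` closes a loop. -/
theorem takeWhile_ne_append_prefix {V : Type*} [DecidableEq V] (m : List V) (x : V) :
    m.takeWhile (fun a => decide (a ≠ x)) ++ [x] <+: m ++ [x] := by
  induction m with
  | nil => simp
  | cons a m ih =>
    by_cases h : a = x
    · subst h; simp
    · simpa [h] using ih

variable {V : Type*} [Fintype V] [DecidableEq V]

/-- The array `root` is right on the finished nodes, whose pointers lead to a root. -/
def Settled (st : State V) : Prop :=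
  ∀ v ∈ finished st, ∃ r, Leads st.next (finished st) v r ∧ st.root v = some r

/-- The invariant of the program. The list `l` holds the nodes of the current branch in front of
the current node, or those that are still to be retraced. -/
inductive Inv (G : WDigraph V) (st : State V) (l : List V) : Prop
  | head (adj : ∀ u x, st.next u = some x → G.Adj u x) (hc : st.control = .head) (hl : l = [])
      (cov : ∀ v, v ∈ finished st ∨ v ∈ st.todo) (settled : Settled st)
  | walk (adj : ∀ u x, st.next u = some x → G.Adj u x) (i u : V) (hc : st.control = .walk i u)
      (cov : ∀ v, v ∈ finished st ∨ v ∈ st.todo ∨ v = i) (settled : Settled st)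
      (hi : (l ++ [u]).head? = some i) (nodup : (l ++ [u]).Nodup)
      (disj : ∀ v ∈ l, v ∉ finished st)
      (chain : List.IsChain (fun a b => st.next a = some b) (l ++ [u]))
  | retrace (adj : ∀ u x, st.next u = some x → G.Adj u x) (r : Option V) (u y : V)
      (hc : st.control = .retrace r u) (cov : ∀ v, v ∈ finished st ∪ l.toFinset ∨ v ∈ st.todo)
      (hy : y ∈ finished st) (hu : (l ++ [y]).head? = some u) (nodup : l.Nodup)
      (disj : ∀ v ∈ l, v ∉ finished st)
      (chain : List.IsChain (fun a b => st.next a = some b) (l ++ [y]))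
      (settled : ∀ v ∈ finished st ∪ l.toFinset, ∃ r',
        Leads st.next (finished st ∪ l.toFinset) v r' ∧ (v ∈ finished st → st.root v = some r') ∧
          (v ∈ l → r = some r'))

/-- The probability that the program ends with the pointers `f`. -/
noncomputable def value (G : WDigraph V) (f : V → Option V) (st : State V) (l : List V) : ℝ :=
  match st.control with
  | .head =>
    if ∀ v ∈ finished st, st.next v = f v then completion (choiceProb G) f (finished st) else 0
  | .walk _ u =>
    if ∀ v ∈ finished st, st.next v = f v then walkValue (choiceProb G) f (finished st) l u else 0
  | .retrace _ _ =>
    if ∀ v ∈ finished st ∪ l.toFinset, st.next v = f v then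
      completion (choiceProb G) f (finished st ∪ l.toFinset) else 0

/-- The list of the invariant after the random choice `o` made in `u`. -/
def walkList (l : List V) (u : V) : Option V → List V
  | none => l
  | some x => (l ++ [u]).takeWhile (fun a => decide (a ≠ x))

theorem Inv.step_head {G : WDigraph V} {st : State V} {l : List V} {i : V} {rest : List V}
    (h : Inv G st l) (hc : st.control = .head) (ht : st.todo = i :: rest) :
    Inv G { st with todo := rest, control := .walk i i } [] ∧
      ∀ f, value G f { st with todo := rest, control := .walk i i } [] = value G f st l := by
  cases h with
  | walk _ _ _ hc' => simp [hc] at hc'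
  | retrace _ _ _ _ hc' => simp [hc] at hc'
  | head adj _ hl cov settled =>
    constructor
    · refine .walk adj i i rfl (fun v => ?_) settled (by simp) (by simp) (by simp) (by simp)
      have := cov v
      rw [ht, List.mem_cons] at this
      change v ∈ finished st ∨ v ∈ rest ∨ v = i
      tauto
    · intro f
      simp only [value, hc, walkValue]
      rfl

theorem Inv.step_walk_of_inForest {G : WDigraph V} {st : State V} {l : List V} {i u : V}
    (h : Inv G st l) (hc : st.control = .walk i u) (hu : st.inForest u = true) :
    Inv G { st with control := .retrace (st.root u) i } l ∧
      ∀ f, value G f { st with control := .retrace (st.root u) i } l = value G f st l := by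
  cases h with
  | head _ hc' => simp [hc] at hc'
  | retrace _ _ _ _ hc' => simp [hc] at hc'
  | walk adj i' u' hc' cov settled hi nodup disj chain =>
    obtain ⟨rfl, rfl⟩ : i = i' ∧ u = u' := by simpa [hc] using hc'
    have hu' := mem_finished.2 hu
    have hfin : finished { st with control := .retrace (st.root u) i } = finished st := rfl
    constructor
    · refine .retrace adj (st.root u) i u rfl (fun v => ?_) hu' hi nodup.of_append_left disj
        chain ?_
      · rw [hfin, Finset.mem_union, List.mem_toFinset]
        change (v ∈ finished st ∨ v ∈ l) ∨ v ∈ st.todo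
        rcases cov v with h | h | h
        · tauto
        · tauto
        · subst h
          cases l with
          | nil =>
            obtain rfl : u = v := by simpa using hi
            tauto
          | cons a l =>
            obtain rfl : a = v := by simpa using hi
            simp
      · rw [hfin]
        intro v hv
        obtain ⟨r, hr, hur⟩ := settled u hu'
        have hr' : Leads st.next (finished st ∪ l.toFinset) u r :=
          hr.mono Finset.subset_union_left fun _ _ => rfl
        by_cases hvT : v ∈ finished st
        · obtain ⟨r', hr1, hr2⟩ := settled v hvT
          exact ⟨r', hr1.mono Finset.subset_union_left fun _ _ => rfl, fun _ => hr2,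
            fun h => absurd hvT (disj v h)⟩
        · have hvl : v ∈ l := by simpa [hvT] using hv
          exact ⟨r, hr'.of_isChain chain (fun v hv => by simp [hv]) v hvl,
            fun h => absurd h hvT, fun _ => hur⟩
    · intro f
      simp only [value, hc]
      rw [hfin]
      -- The walk has reached a finished node, so the pointers on its path are final and its value
      -- collapses to that of the retracing phase.
      have hw := walkValue_of_mem (isKilledWalk_choiceProb G) f hu' nodup.of_append_left disj
      rw [isChain_iff_of_isChain chain] at hw
      have hall : (∀ v ∈ finished st ∪ l.toFinset, st.next v = f v) ↔
          (∀ v ∈ finished st, st.next v = f v) ∧ ∀ v ∈ l, st.next v = f v := by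
        simp only [Finset.mem_union, List.mem_toFinset, or_imp, forall_and]
      by_cases h1 : ∀ v ∈ finished st, st.next v = f v
      · rw [if_pos h1]
        by_cases h2 : ∀ v ∈ l, st.next v = f v
        · rw [if_pos (hall.2 ⟨h1, h2⟩), hw.1 h2]
        · rw [if_neg (fun h => h2 (hall.1 h).2), hw.2 h2]
      · rw [if_neg h1, if_neg (fun h => h1 (hall.1 h).1)]

theorem Inv.step_retrace_of_inForest {G : WDigraph V} {st : State V} {l : List V} {r : Option V}
    {u : V} (h : Inv G st l) (hc : st.control = .retrace r u) (hu : st.inForest u = true) :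
    Inv G { st with control := .head } [] ∧
      ∀ f, value G f { st with control := .head } [] = value G f st l := by
  cases h with
  | head _ hc' => simp [hc] at hc'
  | walk _ _ _ hc' => simp [hc] at hc'
  | retrace adj r' u' y hc' cov hy hhd nodup disj chain settled =>
    obtain ⟨rfl, rfl⟩ : r = r' ∧ u = u' := by simpa [hc] using hc'
    have hu' := mem_finished.2 hu
    obtain rfl : l = [] := by
      cases l with
      | nil => rfl
      | cons a l =>
        obtain rfl : a = u := by simpa using hhd
        exact absurd hu' (disj a (by simp))
    have hT : finished st ∪ ([] : List V).toFinset = finished st := by simp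
    rw [hT] at cov settled
    constructor
    · refine .head adj rfl rfl cov fun v hv => ?_
      obtain ⟨r', h1, h2, -⟩ := settled v hv
      exact ⟨r', h1, h2 hv⟩
    · intro f
      simp only [value, hc, hT]
      rfl

theorem Inv.step_retrace {G : WDigraph V} {st : State V} {l : List V} {r : Option V}
    {u : V} (h : Inv G st l) (hc : st.control = .retrace r u) (hu : st.inForest u = false) :
    ∃ st' l', step G st = PMF.pure st' ∧ Inv G st' l' ∧ ∀ f, value G f st' l' = value G f st l := by
  cases h with
  | head _ hc' => simp [hc] at hc'
  | walk _ _ _ hc' => simp [hc] at hc'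
  | retrace adj r' u' y hc' cov hy hhd nodup disj chain settled =>
    obtain ⟨rfl, rfl⟩ : r = r' ∧ u = u' := by simpa [hc] using hc'
    have hu' := notMem_finished.2 hu
    cases l with
    | nil =>
      obtain rfl : y = u := by simpa using hhd
      exact absurd hy hu'
    | cons a l =>
      obtain rfl : a = u := by simpa using hhd
      rw [isChain_cons_append] at chain
      obtain ⟨x, hx⟩ : ∃ x, (l ++ [y]).head? = some x := by cases l <;> simp
      have hnext : st.next a = some x := chain.1.trans hx
      let st' : State V := { st with
        inForest := Function.update st.inForest a true
        root := Function.update st.root a r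
        control := .retrace r x }
      have hstep : step G st = PMF.pure st' := by
        rw [RandomForest.step_retrace hc hu, hnext]
      have hfin : finished st' = insert a (finished st) := finished_update rfl
      have hU : finished st' ∪ l.toFinset = finished st ∪ (a :: l).toFinset := by
        rw [hfin]; ext; simp
      rw [List.nodup_cons] at nodup
      refine ⟨st', l, hstep, .retrace adj r x y rfl (by rwa [hU]) (by simp [hfin, hy]) hx nodup.2
        (fun v hv => ?_) chain.2 ?_, ?_⟩
      · rw [hfin, Finset.mem_insert, not_or]
        exact ⟨fun h => nodup.1 (h ▸ hv), disj v (by simp [hv])⟩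
      · rw [hU]
        intro v hv
        obtain ⟨r', h1, h2, h3⟩ := settled v hv
        refine ⟨r', h1, fun h => ?_, fun h => h3 (by simp [h])⟩
        by_cases hva : v = a
        · subst hva
          simpa [st'] using h3 (by simp)
        · have hvT : v ∈ finished st := by simpa [hfin, hva] using h
          simpa [st', hva] using h2 hvT
      · intro f
        have : value G f st' l = if ∀ v ∈ finished st' ∪ l.toFinset, st.next v = f v then
          completion (choiceProb G) f (finished st' ∪ l.toFinset) else 0 := rfl
        rw [this, value, hc, hU]

theorem Inv.step_walk {G : WDigraph V} {st : State V} {l : List V} {i u : V}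
    (h : Inv G st l) (hc : st.control = .walk i u) (hu : st.inForest u = false) :
    (∀ o, choiceProb G u o ≠ 0 → Inv G (walkStep st i u o) (walkList l u o)) ∧
      ∀ f, (∀ v, ¬ Relation.TransGen (fun a b => f a = some b) v v) →
        value G f st l =
          ∑ o, choiceProb G u o * value G f (walkStep st i u o) (walkList l u o) := by
  cases h with
  | head _ hc' => simp [hc] at hc'
  | retrace _ _ _ _ hc' => simp [hc] at hc'
  | walk adj i' u' hc' cov settled hi nodup disj chain =>
    obtain ⟨rfl, rfl⟩ : i = i' ∧ u = u' := by simpa [hc] using hc'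
    have hu' := notMem_finished.2 hu
    have hul : u ∉ l := fun h => (List.nodup_append.1 nodup).2.2 u h u (by simp) rfl
    have hfin0 : finished (walkStep st i u none) = insert u (finished st) := finished_update rfl
    have hupd : ∀ o, ∀ v ∈ finished st, Function.update st.next u o v = st.next v :=
      fun o v hv => by
      have hvu : v ≠ u := fun h => hu' (h ▸ hv)
      rw [Function.update_of_ne hvu]
    have hdisj : ∀ v ∈ l ++ [u], v ∉ finished st := by
      intro v hv
      rcases List.mem_append.1 hv with h | h
      · exact disj v h
      · rw [List.mem_singleton.1 h]; exact hu'
    constructor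
    · rintro (_ | x) ho
      · refine .walk ?_ i u hc ?_ ?_ hi nodup ?_ (isChain_update chain hul none)
        · intro v x hvx
          simp only [walkStep] at hvx
          by_cases hv : v = u
          · simp [hv] at hvx
          · rw [Function.update_of_ne hv] at hvx
            exact adj v x hvx
        · intro v
          rw [hfin0]
          rcases cov v with h | h
          · simp [h]
          · exact Or.inr h
        · intro v hv
          rw [hfin0] at hv ⊢
          by_cases hvu : v = u
          · subst hvu
            exact ⟨v, .root (by simp) (by simp [walkStep]), by simp [walkStep]⟩
          · obtain ⟨r, h1, h2⟩ := settled v (by simpa [hvu] using hv)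
            exact ⟨r, h1.mono (Finset.subset_insert _ _) (hupd none), by simp [walkStep, hvu, h2]⟩
        · intro v hv
          rw [hfin0, Finset.mem_insert, not_or]
          exact ⟨fun h => hul (h ▸ hv), disj v hv⟩
      · have hadj : G.Adj u x := by
          by_contra h
          exact ho (by simp [choiceProb, WDigraph.adjMatrix, h])
        have hsub : ((l ++ [u]).takeWhile (fun a => decide (a ≠ x))).Sublist (l ++ [u]) :=
          List.takeWhile_sublist _
        have hx : x ∉ (l ++ [u]).takeWhile (fun a => decide (a ≠ x)) := fun h => by
          simpa using List.mem_takeWhile_imp h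
        refine .walk ?_ i x rfl cov ?_ ?_ ?_ ?_ ?_
        · intro v z hvz
          simp only [walkStep] at hvz
          by_cases hv : v = u
          · subst hv
            obtain rfl : x = z := by simpa using hvz
            exact hadj
          · rw [Function.update_of_ne hv] at hvz
            exact adj v z hvz
        · intro v hv
          obtain ⟨r, h1, h2⟩ := settled v hv
          exact ⟨r, h1.mono (Finset.Subset.refl _) (hupd (some x)), h2⟩
        · rw [walkList, takeWhile_ne_append_head?, hi]
        · rw [walkList, List.nodup_append]
          exact ⟨nodup.sublist hsub, by simp, fun a ha b hb hab => hx (by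
            rw [List.mem_singleton.1 hb] at hab; exact hab ▸ ha)⟩
        · exact fun v hv => hdisj v (hsub.subset hv)
        · refine List.IsChain.prefix ?_ (takeWhile_ne_append_prefix (l ++ [u]) x)
          rw [List.isChain_append]
          refine ⟨isChain_update chain hul (some x), by simp, ?_⟩
          simp [walkStep]
    · intro f hf
      have h0 : value G f (walkStep st i u none) l =
          if ∀ v ∈ finished st, st.next v = f v then
            (if f u = none then walkValue (choiceProb G) f (insert u (finished st)) l u else 0)
          else 0 := by
        have : value G f (walkStep st i u none) l =
            if ∀ v ∈ insert u (finished st), Function.update st.next u none v = f v then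
              walkValue (choiceProb G) f (insert u (finished st)) l u else 0 := by
          rw [← hfin0]
          simp only [value, walkStep, hc]
        rw [this]
        have hiff : (∀ v ∈ insert u (finished st), Function.update st.next u none v = f v) ↔
            f u = none ∧ ∀ v ∈ finished st, st.next v = f v := by
          rw [Finset.forall_mem_insert, Function.update_self, eq_comm]
          exact and_congr_right fun _ => forall₂_congr fun v hv => by rw [hupd none v hv]
        simp only [hiff]
        split_ifs <;> tauto
      have h1 : ∀ x, value G f (walkStep st i u (some x)) (walkList l u (some x)) =
          if ∀ v ∈ finished st, st.next v = f v then
            walkValue (choiceProb G) f (finished st)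
              ((l ++ [u]).takeWhile (fun a => decide (a ≠ x))) x else 0 := by
        intro x
        have hiff : (∀ v ∈ finished st, Function.update st.next u (some x) v = f v) ↔
            ∀ v ∈ finished st, st.next v = f v :=
          forall₂_congr fun v hv => by rw [hupd (some x) v hv]
        have : value G f (walkStep st i u (some x)) (walkList l u (some x)) =
            if ∀ v ∈ finished st, Function.update st.next u (some x) v = f v then
              walkValue (choiceProb G) f (finished st)
                ((l ++ [u]).takeWhile (fun a => decide (a ≠ x))) x else 0 := rfl
        rw [this]
        simp only [hiff]
      rw [Fintype.sum_option]
      simp only [h1]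
      rw [show walkList l u none = l from rfl, h0]
      simp only [value, hc]
      by_cases hT : ∀ v ∈ finished st, st.next v = f v
      · simp only [if_pos hT]
        exact walkValue_eq (isKilledWalk_choiceProb G) hf nodup hdisj
      · simp only [if_neg hT, mul_zero, Finset.sum_const_zero, add_zero]

/-- One step from a state that satisfies the invariant. -/
theorem Inv.step {G : WDigraph V} {st : State V} {l : List V} (h : Inv G st l) :
    st.Halted ∨
    (∃ st' l', RandomForest.step G st = PMF.pure st' ∧ Inv G st' l' ∧
      ∀ f, value G f st' l' = value G f st l) ∨
    ∃ (u : V) (k : Option V → State V) (m : Option V → List V),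
      RandomForest.step G st = (choice G u).map k ∧
      (∀ o, choiceProb G u o ≠ 0 → Inv G (k o) (m o)) ∧
      ∀ f, (∀ v, ¬ Relation.TransGen (fun a b => f a = some b) v v) →
        value G f st l = ∑ o, choiceProb G u o * value G f (k o) (m o) := by
  cases hc : st.control with
  | head =>
    cases ht : st.todo with
    | nil => exact .inl ⟨hc, ht⟩
    | cons i rest => exact .inr (.inl ⟨_, _, RandomForest.step_head hc ht, h.step_head hc ht⟩)
  | walk i u =>
    cases hu : st.inForest u with
    | true =>
      exact .inr (.inl ⟨_, _, RandomForest.step_walk_of_inForest hc hu,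
        h.step_walk_of_inForest hc hu⟩)
    | false => exact .inr (.inr ⟨u, _, _, RandomForest.step_walk hc hu, h.step_walk hc hu⟩)
  | retrace r u =>
    cases hu : st.inForest u with
    | true =>
      exact .inr (.inl ⟨_, _, RandomForest.step_retrace_of_inForest hc hu,
        h.step_retrace_of_inForest hc hu⟩)
    | false => exact .inr (.inl (h.step_retrace hc hu))

end RandomForest

/-! ### Forests as acyclic pointer functions -/

namespace SpanningRootedForest

section Pointer

variable {V : Type*} {G : WDigraph V}

open Classical in
/-- The head of the edge of `F` that leaves `u`. -/
noncomputable def pointer (F : SpanningRootedForest G) (u : V) : Option V :=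
  if h : ∃ x, (u, x) ∈ F.edges then some h.choose else none

theorem pointer_eq_some_iff (F : SpanningRootedForest G) {u x : V} :
    F.pointer u = some x ↔ (u, x) ∈ F.edges := by
  unfold pointer
  split_ifs with h
  · rw [Option.some.injEq]
    exact ⟨fun e => e ▸ h.choose_spec, fun e => F.out_unique _ _ _ h.choose_spec e⟩
  · simpa using fun e => h ⟨x, e⟩

theorem mem_roots_iff (F : SpanningRootedForest G) {u : V} :
    u ∈ F.roots ↔ F.pointer u = none := by
  rw [Option.eq_none_iff_forall_ne_some]
  exact forall_congr' fun x => not_congr F.pointer_eq_some_iff.symm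

theorem not_transGen_pointer (F : SpanningRootedForest G) (v : V) :
    ¬ Relation.TransGen (fun a b => F.pointer a = some b) v v := by
  simp only [pointer_eq_some_iff]
  exact F.acyclic v

theorem pointer_injective :
    Function.Injective (pointer : SpanningRootedForest G → V → Option V) := by
  intro F F' h
  ext e
  rw [← Prod.mk.eta (p := e), ← pointer_eq_some_iff, h, pointer_eq_some_iff]

theorem root_spec [Finite V] (F : SpanningRootedForest G) (u : V) :
    F.pointer (F.root u) = none ∧
      Relation.ReflTransGen (fun a b => F.pointer a = some b) u (F.root u) := by
  simp only [pointer_eq_some_iff]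
  exact ⟨F.mem_roots_iff.1 (F.exists_root u).choose_spec.1, (F.exists_root u).choose_spec.2⟩

theorem eq_of_reflTransGen_of_none {f : V → Option V} {u r r' : V} (hr : f r = none)
    (hr' : f r' = none) (h : Relation.ReflTransGen (fun a b => f a = some b) u r)
    (h' : Relation.ReflTransGen (fun a b => f a = some b) u r') : r = r' := by
  have key : ∀ a b, f a = none → Relation.ReflTransGen (fun a b => f a = some b) a b → a = b := by
    intro a b ha hab
    rcases Relation.ReflTransGen.cases_head hab with h | ⟨c, hc, -⟩
    · exact h
    · simp [ha] at hc
  rcases Relation.ReflTransGen.total_of_right_unique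
    (fun a b c hb hc => Option.some.inj (hb.symm.trans hc)) h h' with h1 | h1
  · exact key _ _ hr h1
  · exact (key _ _ hr' h1).symm

theorem root_eq [Finite V] (F : SpanningRootedForest G) {u r : V} (hr : F.pointer r = none)
    (h : Relation.ReflTransGen (fun a b => F.pointer a = some b) u r) : F.root u = r :=
  eq_of_reflTransGen_of_none (F.root_spec u).1 hr (F.root_spec u).2 h

variable [Fintype V] [DecidableEq V]

/-- The forest with the given pointers. -/
def ofPointer (f : V → Option V) (adj : ∀ u x, f u = some x → G.Adj u x)
    (acyclic : ∀ v, ¬ Relation.TransGen (fun a b => f a = some b) v v) :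
    SpanningRootedForest G where
  edges := {e | f e.1 = some e.2}
  edges_sub i j h := adj i j (by simpa using h)
  out_unique i j k hj hk := by
    rw [Finset.mem_filter_univ] at hj hk
    exact Option.some.inj (hj.symm.trans hk)
  acyclic v := by simpa using acyclic v

theorem pointer_ofPointer (f : V → Option V) (adj : ∀ u x, f u = some x → G.Adj u x)
    (acyclic : ∀ v, ¬ Relation.TransGen (fun a b => f a = some b) v v) :
    (ofPointer f adj acyclic).pointer = f := by
  funext u
  ext x
  rw [pointer_eq_some_iff]
  simp [ofPointer]

/-- Every node is the tail of at most one edge; a root contributes the factor one. This matches the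
numerators of `choiceProb`. -/
theorem weight_eq_prod_pointer (F : SpanningRootedForest G) :
    F.weight = ∏ u, (F.pointer u).elim 1 (fun x => G.adjMatrix u x) := by
  rw [weight, ← Finset.prod_fiberwise F.edges Prod.fst]
  refine Finset.prod_congr rfl fun u _ => ?_
  cases h : F.pointer u with
  | none =>
    rw [Finset.prod_eq_one]
    · rfl
    · rintro ⟨a, x⟩ he
      obtain ⟨h1, rfl⟩ := Finset.mem_filter.1 he
      rw [← pointer_eq_some_iff, h] at h1
      cases h1
  | some x =>
    have hx := F.pointer_eq_some_iff.1 h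
    have : F.edges.filter (fun e => e.1 = u) = {(u, x)} := by
      ext ⟨a, b⟩
      rw [Finset.mem_filter, Finset.mem_singleton, Prod.mk.injEq]
      constructor
      · rintro ⟨h1, rfl⟩
        exact ⟨rfl, F.out_unique _ _ _ h1 hx⟩
      · rintro ⟨rfl, rfl⟩
        exact ⟨hx, rfl⟩
    rw [this, Finset.prod_singleton]
    simp [WDigraph.adjMatrix, F.edges_sub u x hx]

end Pointer

end SpanningRootedForest

/-! ### The law of the returned forest -/

namespace RandomForest

open LoopErasedWalk

variable {V : Type*} [Fintype V] [DecidableEq V] {G : WDigraph V}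

theorem Inv.of_halted {st : State V} {l : List V} (h : Inv G st l) (hH : st.Halted) :
    finished st = Finset.univ ∧ (∀ u x, st.next u = some x → G.Adj u x) ∧ Settled st := by
  cases h with
  | walk _ _ _ hc' => simp [hH.1] at hc'
  | retrace _ _ _ _ hc' => simp [hH.1] at hc'
  | head adj _ hl cov settled =>
    refine ⟨?_, adj, settled⟩
    ext v
    simpa [hH.2] using cov v

/-- The array `root` imposes no further condition: all nodes are finished, and the invariant makes
it correct there. -/
theorem Inv.represents_iff {st : State V} {l : List V} (h : Inv G st l) (hH : st.Halted)
    (F : SpanningRootedForest G) : Represents st F ↔ st.next = F.pointer := by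
  obtain ⟨huniv, -, hset⟩ := h.of_halted hH
  constructor
  · rintro ⟨hn, -⟩
    funext u
    ext x
    rw [← hn, F.pointer_eq_some_iff]
  · intro hn
    refine ⟨fun u x => by rw [hn, F.pointer_eq_some_iff], fun u => ?_⟩
    obtain ⟨r, h1, h2⟩ := hset u (by simp [huniv])
    rw [h2, F.root_eq (hn ▸ h1.next_eq_none) (hn ▸ h1.reflTransGen)]

theorem Inv.existsUnique_represents {st : State V} {l : List V} (h : Inv G st l)
    (hH : st.Halted) : ∃! F : SpanningRootedForest G, Represents st F := by
  obtain ⟨huniv, adj, hset⟩ := h.of_halted hH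
  have hac : ∀ v, ¬ Relation.TransGen (fun a b => st.next a = some b) v v := fun v =>
    (hset v (by simp [huniv])).choose_spec.1.not_transGen_self
  refine ⟨.ofPointer st.next adj hac, ?_, fun F hF => ?_⟩
  · simp only [h.represents_iff hH, SpanningRootedForest.pointer_ofPointer]
  · apply SpanningRootedForest.pointer_injective
    rw [SpanningRootedForest.pointer_ofPointer, (h.represents_iff hH F).1 hF]

theorem Inv.value_of_halted {st : State V} {l : List V} (h : Inv G st l) (hH : st.Halted)
    (f : V → Option V) : value G f st l = if st.next = f then 1 else 0 := by
  obtain ⟨huniv, -, -⟩ := h.of_halted hH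
  simp only [value, hH.1, huniv, completion_univ, Finset.mem_univ, true_imp_iff, funext_iff]

theorem exists_abs_value_le (G : WDigraph V) (f : V → Option V) :
    ∃ C, ∀ st l, Inv G st l → |value G f st l| ≤ C := by
  obtain ⟨C, hC⟩ := exists_abs_walkValue_le (choiceProb G) f
  let K := ∑ A : Finset V, |completion (choiceProb G) f A|
  have hK : ∀ A, |completion (choiceProb G) f A| ≤ K := fun A =>
    Finset.single_le_sum (f := fun A : Finset V => |completion (choiceProb G) f A|)
      (fun _ _ => abs_nonneg _) (Finset.mem_univ A)
  have hK0 : 0 ≤ K := (abs_nonneg _).trans (hK ∅)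
  refine ⟨max C K, fun st l h => ?_⟩
  have h0 : (0 : ℝ) ≤ max C K := le_max_of_le_right hK0
  cases h with
  | head _ hc =>
    simp only [value, hc]
    split_ifs
    · exact (hK _).trans (le_max_right _ _)
    · simpa using h0
  | retrace _ _ _ _ hc =>
    simp only [value, hc]
    split_ifs
    · exact (hK _).trans (le_max_right _ _)
    · simpa using h0
  | walk _ _ _ hc _ _ _ nodup =>
    simp only [value, hc]
    split_ifs
    · exact (hC _ _ _ nodup.of_append_left).trans (le_max_left _ _)
    · simpa using h0

/-- Optional stopping: the value is harmonic and equals the indicator of `S` at halted states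
satisfying the invariant, so after `t` steps the error lives on the runs still going, where it is at
most `C`. -/
theorem Inv.abs_value_sub_probIn_le {f : V → Option V}
    (hf : ∀ v, ¬ Relation.TransGen (fun a b => f a = some b) v v) {C : ℝ}
    (hC : ∀ st l, Inv G st l → |value G f st l| ≤ C) {S : Set (State V)}
    (hSH : ∀ st ∈ S, st.Halted)
    (hS : ∀ st l, Inv G st l → st.Halted → (st ∈ S ↔ st.next = f)) (t : ℕ) {st : State V}
    {l : List V} (h : Inv G st l) :
    |value G f st l - probIn G S t st| ≤ C * probIn G {st | ¬ st.Halted} t st := by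
  induction t generalizing st l with
  | zero =>
    simp only [probIn_zero]
    by_cases hH : st.Halted
    · simp only [h.value_of_halted hH, hS st l h hH, Set.mem_ofPred_eq, hH, not_true, if_false,
        mul_zero]
      split_ifs <;> simp
    · rw [if_neg (fun h => hH (hSH st h)), if_pos (show st ∈ {st : State V | ¬ st.Halted} from hH)]
      simpa using hC st l h
  | succ t ih =>
    rcases h.step with hH | ⟨st', l', hstep, hinv, hval⟩ | ⟨u, k, m, hstep, hinv, hval⟩
    · rw [probIn_succ_of_pure (step_halted hH), probIn_succ_of_pure (step_halted hH)]
      exact ih h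
    · rw [probIn_succ_of_pure hstep, probIn_succ_of_pure hstep, ← hval]
      exact ih hinv
    · rw [probIn_succ_of_map hstep, probIn_succ_of_map hstep, hval f hf, ← Finset.sum_sub_distrib,
        Finset.mul_sum]
      refine (Finset.abs_sum_le_sum_abs _ _).trans (Finset.sum_le_sum fun o _ => ?_)
      by_cases ho : choiceProb G u o = 0
      · simp [ho]
      · rw [← mul_sub, abs_mul, abs_of_nonneg ((isKilledWalk_choiceProb G).nonneg u o),
          mul_left_comm]
        exact mul_le_mul_of_nonneg_left (ih (hinv o ho)) ((isKilledWalk_choiceProb G).nonneg u o)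

/-- The final states that represent `F`. -/
def outcome (F : SpanningRootedForest G) : Set (State V) := {st | st.Halted ∧ Represents st F}

/-- By the invariant a halted run represents exactly one forest, so no mass escapes. -/
theorem Inv.sum_probIn_outcome (t : ℕ) {st : State V} {l : List V} (h : Inv G st l) :
    ∑ F : SpanningRootedForest G, probIn G (outcome F) t st +
      probIn G {st | ¬ st.Halted} t st = 1 := by
  induction t generalizing st l with
  | zero =>
    simp only [probIn_zero]
    by_cases hH : st.Halted
    · obtain ⟨F, hF, huniq⟩ := h.existsUnique_represents hH
      rw [Finset.sum_eq_single F]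
      · simp [outcome, hH, hF]
      · intro F' _ hne
        exact if_neg fun h => hne (huniq F' h.2)
      · simp
    · simp [outcome, hH]
  | succ t ih =>
    rcases h.step with hH | ⟨st', l', hstep, hinv, -⟩ | ⟨u, k, m, hstep, hinv, -⟩
    · simp only [probIn_succ_of_pure (step_halted hH)]
      exact ih h
    · simp only [probIn_succ_of_pure hstep]
      exact ih hinv
    · simp only [probIn_succ_of_map hstep]
      rw [Finset.sum_comm, ← Finset.sum_add_distrib, ← (isKilledWalk_choiceProb G).sum_eq_one u]
      refine Finset.sum_congr rfl fun o _ => ?_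
      rw [← Finset.mul_sum, ← mul_add]
      by_cases ho : choiceProb G u o = 0
      · simp [ho]
      · rw [ih (hinv o ho), mul_one]

theorem inv_init {order : List V} (horder : ∀ u, u ∈ order) : Inv G (init order) [] := by
  refine .head (by simp [init]) rfl rfl (fun v => Or.inr (horder v)) fun v hv => ?_
  simp [mem_finished, init] at hv

theorem value_init (G : WDigraph V) (order : List V) (f : V → Option V) :
    value G f (init order) [] = completion (choiceProb G) f ∅ := by
  have : finished (init order : State V) = ∅ := by ext; simp [mem_finished, init]
  have hc : (init order : State V).control = .head := rfl
  simp [value, hc, this]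

theorem tendsto_probIn_not_halted (G : WDigraph V) (st : State V) :
    Filter.Tendsto (fun t => probIn G {st | ¬ st.Halted} t st) Filter.atTop (nhds 0) := by
  refine squeeze_zero' (.of_forall fun t => probIn_nonneg _ _ _ _) ?_
    (tendsto_const_div_atTop_nhds_zero_nat (potential G st))
  filter_upwards [Filter.eventually_gt_atTop 0] with t ht
  rw [le_div_iff₀ (by exact_mod_cast ht), mul_comm]
  exact mul_probIn_not_halted_le G t st

theorem tendsto_probIn_outcome {order : List V} (horder : ∀ u, u ∈ order)
    (F : SpanningRootedForest G) :
    Filter.Tendsto (fun t => probIn G (outcome F) t (init order)) Filter.atTop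
      (nhds (completion (choiceProb G) F.pointer ∅)) := by
  obtain ⟨C, hC⟩ := exists_abs_value_le G F.pointer
  have hle := fun t => Inv.abs_value_sub_probIn_le F.not_transGen_pointer hC
    (S := outcome F) (fun st h => h.1)
    (fun st l h hH => by
      simp only [outcome, Set.mem_ofPred_eq, hH, true_and, h.represents_iff hH]) t
    (inv_init (G := G) horder)
  simp only [value_init] at hle
  have h0 := (tendsto_probIn_not_halted G (init order)).const_mul C
  rw [mul_zero] at h0
  rw [tendsto_iff_dist_tendsto_zero]
  refine squeeze_zero (fun _ => dist_nonneg) (fun t => ?_) h0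
  rw [dist_comm, Real.dist_eq]
  exact hle t

/-- The factor beside the weight does not depend on `F`, so its value is not needed. -/
theorem completion_pointer (F : SpanningRootedForest G) :
    completion (choiceProb G) F.pointer ∅ =
      F.weight * ((∏ u, (1 + G.outDegree u))⁻¹ / (sinkMatrix (choiceProb G) ∅).det) := by
  rw [completion, F.weight_eq_prod_pointer, Finset.compl_empty]
  simp only [choiceProb]
  rw [Finset.prod_div_distrib]
  ring

/-- Limit of the conservation of mass, the share of the unfinished runs tending to zero. -/
theorem sum_completion_pointer (G : WDigraph V) :
    ∑ F : SpanningRootedForest G, completion (choiceProb G) F.pointer ∅ = 1 := by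
  have horder : ∀ u : V, u ∈ Finset.univ.toList := fun u => by simp
  have h1 := (tendsto_finsetSum Finset.univ
    fun (F : SpanningRootedForest G) _ => tendsto_probIn_outcome horder F).add
      (tendsto_probIn_not_halted G (init Finset.univ.toList))
  simp only [(inv_init (G := G) horder).sum_probIn_outcome, add_zero] at h1
  exact tendsto_nhds_unique h1 tendsto_const_nhds

theorem completion_pointer_eq_div (F : SpanningRootedForest G) :
    completion (choiceProb G) F.pointer ∅ =
      F.weight / ∑ F' : SpanningRootedForest G, F'.weight := by
  have h := sum_completion_pointer G
  simp only [completion_pointer] at h ⊢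
  rw [← Finset.sum_mul] at h
  rw [eq_inv_of_mul_eq_one_right h, div_eq_mul_inv]

/-- Halted states are absorbing; hence the supremum in `prob` is a limit. -/
theorem monotone_toOuterMeasure_run (G : WDigraph V) (order : List V) {S : Set (State V)}
    (hS : ∀ st ∈ S, st.Halted) :
    Monotone fun t => (run G order t).toOuterMeasure S := by
  refine monotone_nat_of_le_succ fun t => ?_
  have : run G order (t + 1) = (run G order t).bind (step G) := Function.iterate_succ_apply' _ _ _
  rw [this, PMF.toOuterMeasure_bind_apply, PMF.toOuterMeasure_apply]
  refine ENNReal.tsum_le_tsum fun st => ?_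
  by_cases h : st ∈ S
  · simp [h, step_halted (hS st h), PMF.toOuterMeasure_pure_apply]
  · simp [h]

theorem prob_eq (G : WDigraph V) {order : List V} (horder : ∀ u, u ∈ order)
    (F : SpanningRootedForest G) :
    prob G order F = ENNReal.ofReal (F.weight / ∑ F' : SpanningRootedForest G, F'.weight) := by
  have h1 := tendsto_atTop_iSup (monotone_toOuterMeasure_run G order (S := outcome F)
    fun st h => h.1)
  have h2 := ENNReal.tendsto_ofReal (tendsto_probIn_outcome horder F)
  rw [completion_pointer_eq_div] at h2
  refine tendsto_nhds_unique h1 (h2.congr fun t => ?_)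
  exact ENNReal.ofReal_toReal (toOuterMeasure_ne_top _ _)

end RandomForest

/-! ### Pointer exchange and the linear system for the root weights -/

namespace SpanningRootedForest

theorem not_transGen_self_of_reflTransGen {V : Type*} {f : V → Option V} {v r : V}
    (h : Relation.ReflTransGen (fun a b => f a = some b) v r) (hr : f r = none) :
    ¬ Relation.TransGen (fun a b => f a = some b) v v := by
  induction h using Relation.ReflTransGen.head_induction_on with
  | refl =>
    intro ht
    obtain ⟨b, hb, -⟩ := Relation.TransGen.head'_iff.1 ht
    simp [hr] at hb
  | head h _ ih =>
    intro ht
    obtain ⟨b, hb, hbv⟩ := Relation.TransGen.head'_iff.1 ht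
    obtain rfl : _ = b := Option.some.inj (h.symm.trans hb)
    exact ih (Relation.TransGen.tail' hbv h)

theorem reflTransGen_congr {V : Type*} {f g : V → Option V} {x r u : V}
    (h : Relation.ReflTransGen (fun a b => f a = some b) x r)
    (hu : ¬ Relation.ReflTransGen (fun a b => f a = some b) x u)
    (hfg : ∀ v, v ≠ u → f v = g v) : Relation.ReflTransGen (fun a b => g a = some b) x r := by
  induction h with
  | refl => exact .refl
  | tail hxb hbc ih =>
    refine ih.tail ?_
    rw [← hfg _ fun h => hu (h ▸ hxb)]
    exact hbc

section Surgery

variable {V : Type*} [Fintype V] [DecidableEq V] {G : WDigraph V}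

/-- The path from `x` avoids `u`, as it would otherwise close a cycle in `F'`; so it is the same
path in `F`. -/
theorem root_of_update_some {F F' : SpanningRootedForest G} {u x : V}
    (h : F'.pointer = Function.update F.pointer u (some x)) : F'.root u = F.root x := by
  have hu : F'.pointer u = some x := by simp [h]
  have hne : ∀ v, v ≠ u → F'.pointer v = F.pointer v := fun v hv => by simp [h, hv]
  obtain ⟨h1, h2⟩ := F'.root_spec x
  have hxu : ¬ Relation.ReflTransGen (fun a b => F'.pointer a = some b) x u := fun hxu =>
    F'.not_transGen_pointer u (.head' hu hxu)
  have hru : F'.root x ≠ u := fun hr => hxu (hr ▸ h2)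
  rw [F'.root_eq h1 (.head hu h2),
    F.root_eq (by rw [← hne _ hru]; exact h1) (reflTransGen_congr h2 hxu hne)]

/-- A new cycle must use the edge from `u` to `x`, so `x` already led to `u` in `F`. -/
theorem root_eq_of_cyclic_update {F : SpanningRootedForest G} {u x : V}
    (h : ¬ ∀ v, ¬ Relation.TransGen
      (fun a b => Function.update F.pointer u (some x) a = some b) v v) :
    F.root x = F.root u := by
  by_cases hxu : Relation.ReflTransGen (fun a b => F.pointer a = some b) x u
  · obtain ⟨h1, h2⟩ := F.root_spec u
    exact F.root_eq h1 (hxu.trans h2)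
  · refine absurd (fun v => ?_) h
    set g := Function.update F.pointer u (some x) with hg
    have hgu : g u = some x := by simp [hg]
    have hne : ∀ v, v ≠ u → F.pointer v = g v := fun v hv => by simp [hg, hv]
    have hx : Relation.ReflTransGen (fun a b => g a = some b) x (F.root x) ∧
        g (F.root x) = none := by
      obtain ⟨h1, h2⟩ := F.root_spec x
      refine ⟨reflTransGen_congr h2 hxu hne, ?_⟩
      rw [← hne _ fun hr => hxu (hr ▸ h2), h1]
    -- If `x` does not lead to `u`, every node still reaches a root: follow `F` until the root or
    -- until `u`, and from `u` go on along the path of `x`.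
    have hv : ∃ r, Relation.ReflTransGen (fun a b => g a = some b) v r ∧ g r = none := by
      obtain ⟨h1, h2⟩ := F.root_spec v
      generalize F.root v = w at h1 h2
      induction h2 using Relation.ReflTransGen.head_induction_on with
      | refl =>
        by_cases hr : w = u
        · rw [hr]
          exact ⟨_, .head hgu hx.1, hx.2⟩
        · exact ⟨_, .refl, by rw [← hne _ hr, h1]⟩
      | @head a c hac _ ih =>
        by_cases ha : a = u
        · subst ha
          exact ⟨_, .head hgu hx.1, hx.2⟩
        · obtain ⟨r, hr1, hr2⟩ := ih
          exact ⟨r, .head (by rw [← hne _ ha]; exact hac) hr1, hr2⟩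
    obtain ⟨r, hr1, hr2⟩ := hv
    exact not_transGen_self_of_reflTransGen hr1 hr2

theorem acyclic_update_none {V : Type*} [DecidableEq V] {G : WDigraph V}
    (F : SpanningRootedForest G) (u v : V) :
    ¬ Relation.TransGen (fun a b => Function.update F.pointer u none a = some b) v v := by
  intro h
  refine F.not_transGen_pointer v (Relation.TransGen.mono (fun a b hab => ?_) _ _ h)
  by_cases ha : a = u
  · simp [ha] at hab
  · simpa [ha] using hab

/-- The pointer of `u` may be replaced by `o` in the forest `F`. -/
def CanRedirect (F : SpanningRootedForest G) (u : V) (o : Option V) : Prop :=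
  (∀ v x, Function.update F.pointer u o v = some x → G.Adj v x) ∧
    ∀ v, ¬ Relation.TransGen (fun a b => Function.update F.pointer u o a = some b) v v

theorem adj_of_pointer {V : Type*} {G : WDigraph V} (F : SpanningRootedForest G) {v x : V}
    (h : F.pointer v = some x) : G.Adj v x := F.edges_sub v x (F.pointer_eq_some_iff.1 h)

open Classical in
/-- The exchange of the pointer of `u` with `o`, where it leads to a forest. -/
noncomputable def redirect (u : V) (e : SpanningRootedForest G × Option V) :
    SpanningRootedForest G × Option V :=
  if h : CanRedirect e.1 u e.2 then (ofPointer _ h.1 h.2, e.1.pointer u) else e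

theorem redirect_involutive (u : V) :
    Function.Involutive (redirect u : SpanningRootedForest G × Option V → _) := by
  rintro ⟨F, o⟩
  by_cases h : CanRedirect F u o
  · have h1 : redirect u (F, o) = (ofPointer _ h.1 h.2, F.pointer u) := dif_pos h
    rw [h1]
    have h2 : Function.update (ofPointer _ h.1 h.2).pointer u (F.pointer u) = F.pointer := by
      simp [pointer_ofPointer]
    have h3 : CanRedirect (ofPointer _ h.1 h.2) u (F.pointer u) := by
      unfold CanRedirect
      rw [h2]
      exact ⟨fun v x => F.adj_of_pointer, F.not_transGen_pointer⟩
    have h4 : redirect u (ofPointer _ h.1 h.2, F.pointer u) =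
      (ofPointer _ h3.1 h3.2, (ofPointer _ h.1 h.2).pointer u) := dif_pos h3
    rw [h4]
    refine Prod.ext (pointer_injective ?_) ?_
    · simp only [pointer_ofPointer, Function.update_idem, Function.update_eq_self]
    · simp [pointer_ofPointer]
  · have h1 : redirect u (F, o) = (F, o) := dif_neg h
    rw [h1, h1]

theorem weight_mul_elim_eq {F F' : SpanningRootedForest G} {u : V} {o : Option V}
    (h : F'.pointer = Function.update F.pointer u o) :
    F'.weight * (F.pointer u).elim 1 (fun x => G.adjMatrix u x) =
      F.weight * o.elim 1 (fun x => G.adjMatrix u x) := by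
  rw [weight_eq_prod_pointer, weight_eq_prod_pointer,
    ← Finset.mul_prod_erase _ _ (Finset.mem_univ u),
    ← Finset.mul_prod_erase _ (fun v => (F.pointer v).elim 1 (fun x => G.adjMatrix v x))
      (Finset.mem_univ u)]
  have : ∏ v ∈ Finset.univ.erase u, (F'.pointer v).elim 1 (fun x => G.adjMatrix v x) =
      ∏ v ∈ Finset.univ.erase u, (F.pointer v).elim 1 (fun x => G.adjMatrix v x) := by
    refine Finset.prod_congr rfl fun v hv => ?_
    rw [h, Function.update_of_ne (Finset.ne_of_mem_erase hv)]
  rw [this, h, Function.update_self]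
  ring

/-- The total weight of the forests in which `u` is rooted at `s`. -/
noncomputable def rootWeight (G : WDigraph V) (u s : V) : ℝ :=
  ∑ F : SpanningRootedForest G, F.weight * if F.root u = s then 1 else 0

/-- `redirect` preserves the weight of a pair and makes `o` the pointer of `u`, so the new root of
`u` is the root of the target of `o`, or `u` itself. On pairs it leaves alone, either `o` is a
non-edge and the weight is zero, or a cycle would arise and the two roots coincide. -/
theorem sum_redirect (G : WDigraph V) (u : V) (φ : V → ℝ) :
    ∑ e : SpanningRootedForest G × Option V,
      e.1.weight * e.2.elim 1 (fun x => G.adjMatrix u x) * φ (e.2.elim u e.1.root) =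
    ∑ e : SpanningRootedForest G × Option V,
      e.1.weight * e.2.elim 1 (fun x => G.adjMatrix u x) * φ (e.1.root u) := by
  refine Eq.trans (Finset.sum_congr rfl fun ⟨F, o⟩ _ => ?_)
    (Equiv.sum_comp (redirect_involutive u).toPerm fun e =>
      e.1.weight * e.2.elim 1 (fun x => G.adjMatrix u x) * φ (e.1.root u))
  rw [Function.Involutive.coe_toPerm]
  by_cases h : CanRedirect F u o
  · have h1 : redirect u (F, o) = (ofPointer _ h.1 h.2, F.pointer u) := dif_pos h
    have hp := pointer_ofPointer _ h.1 h.2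
    have hr : (ofPointer _ h.1 h.2).root u = o.elim u F.root := by
      cases o with
      | none => exact root_eq _ (by simp [hp]) .refl
      | some x => exact root_of_update_some hp
    rw [h1]
    simp only [weight_mul_elim_eq hp]
    exact congrArg _ (congrArg φ hr.symm)
  · have h1 : redirect u (F, o) = (F, o) := dif_neg h
    rw [h1]
    cases o with
    | none =>
      refine absurd ⟨fun v x hvx => ?_, F.acyclic_update_none u⟩ h
      by_cases hv : v = u
      · simp [hv] at hvx
      · exact F.adj_of_pointer (by simpa [hv] using hvx)
    | some x =>
      by_cases hadj : G.Adj u x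
      · have hc : ¬ ∀ v, ¬ Relation.TransGen
            (fun a b => Function.update F.pointer u (some x) a = some b) v v := by
          refine fun hc => h ⟨fun v y hvy => ?_, hc⟩
          by_cases hv : v = u
          · subst hv
            obtain rfl : x = y := by simpa using hvy
            exact hadj
          · exact F.adj_of_pointer (by simpa [hv] using hvy)
        simp only [Option.elim, root_eq_of_cyclic_update hc]
      · simp [WDigraph.adjMatrix, hadj]

/-- `sum_redirect` for the indicator of `s`: summing out `o` gives `1 + d_u` on one side and the
average over the out-edges of `u` on the other. -/
theorem one_add_outDegree_mul_rootWeight (G : WDigraph V) (u s : V) :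
    (1 + G.outDegree u) * rootWeight G u s =
      (if u = s then ∑ F : SpanningRootedForest G, F.weight else 0) +
        ∑ x, G.adjMatrix u x * rootWeight G x s := by
  -- The indicator stays opaque while the sums over pairs are rearranged.
  obtain ⟨φ, hφ⟩ : ∃ φ : V → ℝ, ∀ r, (if r = s then (1 : ℝ) else 0) = φ r := ⟨_, fun _ => rfl⟩
  have key := sum_redirect G u φ
  simp only [Fintype.sum_prod_type, Fintype.sum_option, Option.elim, mul_one] at key
  have h1 : (1 + G.outDegree u) * rootWeight G u s =
      ∑ F : SpanningRootedForest G, (F.weight * φ (F.root u) +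
        ∑ x, F.weight * G.adjMatrix u x * φ (F.root u)) := by
    rw [rootWeight, Finset.mul_sum]
    refine Finset.sum_congr rfl fun F _ => ?_
    rw [← Finset.sum_mul, ← Finset.mul_sum, ← WDigraph.outDegree, hφ]
    ring
  rw [h1, ← key, Finset.sum_add_distrib, Finset.sum_comm]
  congr 1
  · rw [← hφ]
    split_ifs <;> simp
  · refine Finset.sum_congr rfl fun x _ => ?_
    rw [rootWeight, Finset.mul_sum]
    exact Finset.sum_congr rfl fun F _ => by rw [hφ]; ring

/-- If the sum were zero, division by it would give every forest limiting probability zero, against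
total mass one. -/
theorem sum_weight_ne_zero (G : WDigraph V) : ∑ F : SpanningRootedForest G, F.weight ≠ 0 := by
  intro h
  have := RandomForest.sum_completion_pointer G
  simp only [RandomForest.completion_pointer_eq_div, h, div_zero, Finset.sum_const_zero] at this
  exact zero_ne_one this

end Surgery

end SpanningRootedForest

/-! ### Root probabilities and personalized PageRank -/

namespace WDigraph

open SpanningRootedForest

variable {V : Type*} [Fintype V] [DecidableEq V] (G : WDigraph V)

theorem transMatrix_apply (hdeg : ∀ i, 0 < G.outDegree i) (i j : V) :
    G.transMatrix i j = G.adjMatrix i j / G.outDegree i := by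
  have : (Matrix.diagonal G.outDegree)⁻¹ = Matrix.diagonal fun i => (G.outDegree i)⁻¹ := by
    apply Matrix.inv_eq_right_inv
    rw [Matrix.diagonal_mul_diagonal, ← Matrix.diagonal_one]
    congr 1
    funext i
    exact mul_inv_cancel₀ (hdeg i).ne'
  rw [transMatrix, this, Matrix.diagonal_mul, inv_mul_eq_div]

theorem adjMatrix_reweight {α : ℝ} (h0 : 0 < α) (h1 : α < 1) (hdeg : ∀ i, 0 < G.outDegree i)
    (i j : V) : (G.reweight α h0 h1).adjMatrix i j = (1 - α) / α * G.transMatrix i j := by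
  rw [transMatrix_apply G hdeg]
  have hα : 1 - α ≠ 0 := (sub_pos.2 h1).ne'
  have hd := (hdeg i).ne'
  by_cases h : G.Adj i j
  · simp only [adjMatrix, reweight, Matrix.of_apply, h, if_true]
    field_simp
  · simp [adjMatrix, reweight, h]

/-- `P` is stochastic, so every out-degree in `G_r` is `(1 - α) / α`; the walk on `G_r` is thus
killed with probability `α` everywhere. -/
theorem one_add_outDegree_reweight {α : ℝ} (h0 : 0 < α) (h1 : α < 1)
    (hdeg : ∀ i, 0 < G.outDegree i) (i : V) :
    1 + (G.reweight α h0 h1).outDegree i = 1 / α := by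
  have : ∑ j, G.transMatrix i j = 1 := by
    simp only [transMatrix_apply G hdeg, ← Finset.sum_div]
    exact div_self (hdeg i).ne'
  rw [outDegree]
  simp only [adjMatrix_reweight G h0 h1 hdeg]
  rw [← Finset.mul_sum, this]
  field_simp
  ring

/-- `Π u s` is the probability that `u` is rooted at `s` in the random forest. -/
theorem pprMatrix_apply {α : ℝ} (h0 : 0 < α) (h1 : α < 1)
    (hdeg : ∀ i, 0 < G.outDegree i) (u s : V) :
    G.pprMatrix α u s = ∑ F : SpanningRootedForest (G.reweight α h0 h1),
      (F.weight / ∑ F' : SpanningRootedForest (G.reweight α h0 h1), F'.weight) *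
        if F.root u = s then 1 else 0 := by
  set Gr := G.reweight α h0 h1
  set Z := ∑ F' : SpanningRootedForest Gr, F'.weight
  have hZ : Z ≠ 0 := sum_weight_ne_zero Gr
  -- The candidate inverse of `I - (1 - α) P`; the factor `α` in the denominator cancels the one in
  -- `Π`.
  let Q : Matrix V V ℝ := Matrix.of fun u s => rootWeight Gr u s / (α * Z)
  have hQ : (1 - (1 - α) • G.transMatrix) * Q = 1 := by
    ext u s
    have h := one_add_outDegree_mul_rootWeight Gr u s
    rw [one_add_outDegree_reweight G h0 h1 hdeg] at h
    simp only [Gr, adjMatrix_reweight G h0 h1 hdeg] at h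
    rw [sub_mul, one_mul, Matrix.sub_apply, smul_mul_assoc, Matrix.smul_apply, Matrix.mul_apply,
      Matrix.one_apply]
    simp only [Q, Matrix.of_apply, smul_eq_mul, ← mul_div_assoc]
    rw [← Finset.sum_div]
    simp only [mul_assoc] at h
    rw [← Finset.mul_sum] at h
    have h' : rootWeight Gr u s - (1 - α) * ∑ x, G.transMatrix u x * rootWeight Gr x s =
        α * if u = s then Z else 0 := by
      field_simp at h
      linear_combination h
    rw [← mul_div_assoc, ← sub_div, h']
    split_ifs
    · field_simp
    · simp
  rw [pprMatrix, Matrix.inv_eq_right_inv hQ, Matrix.smul_apply]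
  simp only [Q, Matrix.of_apply, smul_eq_mul, rootWeight]
  rw [← mul_div_assoc, mul_div_mul_left _ _ h0.ne', Finset.sum_div]
  exact Finset.sum_congr rfl fun F _ => by ring

end WDigraph

/-! ### Hoeffding bounds for means over independent forests -/

/-- Hoeffding's inequality for the mean of independent random variables with values in `[0, 1]`
and the common expectation `m`. -/
theorem measure_abs_mean_sub_gt_le {Ω : Type*} [MeasurableSpace Ω] (P : Measure Ω)
    [IsProbabilityMeasure P] {k : ℕ} {X : Fin k → Ω → ℝ} (hX : ∀ i, Measurable (X i))
    (hind : iIndepFun X P) (h01 : ∀ i ω, X i ω ∈ Set.Icc (0 : ℝ) 1) {m : ℝ}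
    (hm : ∀ i, ∫ ω, X i ω ∂P = m) {ε δ : ℝ} (hε : 0 < ε) (hδ0 : 0 < δ) (hδ1 : δ < 1)
    (hk : 1 / (2 * ε ^ 2) * Real.log (2 / δ) ≤ k) :
    P {ω | ε < |(1 / (k : ℝ)) * ∑ i, X i ω - m|} ≤ ENNReal.ofReal δ := by
  have hlog : 0 < Real.log (2 / δ) := Real.log_pos (by rw [lt_div_iff₀ hδ0]; linarith)
  have hk0 : (0 : ℝ) < k := lt_of_lt_of_le (by positivity) hk
  have hsub : ∀ i, HasSubgaussianMGF (fun ω => X i ω - m) ((‖(1 : ℝ) - 0‖₊ / 2) ^ 2) P := by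
    intro i
    have := hasSubgaussianMGF_of_mem_Icc (μ := P) (hX i).aemeasurable (.of_forall (h01 i))
    rwa [hm i] at this
  -- Variables in `[0, 1]` have sub-Gaussian parameter `1 / 4`. The bound on `k` makes each
  -- one-sided tail at most `δ / 2`.
  have hexp : Real.exp (-(k * ε) ^ 2 /
      (2 * ((∑ _i : Fin k, (‖(1 : ℝ) - 0‖₊ / 2) ^ 2 : NNReal) : ℝ))) ≤ δ / 2 := by
    have h1 : ((∑ _i : Fin k, (‖(1 : ℝ) - 0‖₊ / 2) ^ 2 : NNReal) : ℝ) = k / 4 := by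
      simp
      ring
    rw [h1, ← Real.le_log_iff_exp_le (by positivity)]
    have h2 : -(k * ε) ^ 2 / (2 * (k / 4 : ℝ)) = -(2 * ε ^ 2 * k) := by
      field_simp
      ring
    have h3 : Real.log (δ / 2) = -Real.log (2 / δ) := by rw [← Real.log_inv, inv_div]
    rw [h2, h3, neg_le_neg_iff]
    rw [one_div_mul_eq_div, div_le_iff₀ (by positivity)] at hk
    linarith
  have hup := HasSubgaussianMGF.measure_sum_ge_le_of_iIndepFun (s := Finset.univ)
    (hind.comp (fun _ x => x - m) fun _ => measurable_id.sub_const m) (fun i _ => hsub i)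
    (ε := k * ε) (by positivity)
  have hlow := HasSubgaussianMGF.measure_sum_ge_le_of_iIndepFun (s := Finset.univ)
    (hind.comp (fun _ x => -(x - m)) fun _ => (measurable_id.sub_const m).neg)
    (fun i _ => (hsub i).neg) (ε := k * ε) (by positivity)
  -- The strict deviation is covered by the two non-strict one-sided ones, rescaled by `k`.
  have hincl : {ω | ε < |(1 / (k : ℝ)) * ∑ i, X i ω - m|} ⊆
      {ω | k * ε ≤ ∑ i, ((fun x => x - m) ∘ X i) ω} ∪
        {ω | k * ε ≤ ∑ i, ((fun x => -(x - m)) ∘ X i) ω} := by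
    intro ω hω
    have h1 : (1 / (k : ℝ)) * ∑ i, X i ω - m = (1 / k) * ∑ i, (X i ω - m) := by
      rw [Finset.sum_sub_distrib]
      simp
      field_simp
    rw [Set.mem_ofPred_eq, h1, abs_mul, abs_of_pos (by positivity), one_div_mul_eq_div,
      lt_div_iff₀ hk0, mul_comm] at hω
    simp only [Set.mem_union, Set.mem_ofPred_eq, Function.comp_apply, Finset.sum_neg_distrib]
    rcases lt_abs.1 hω with h | h
    · exact Or.inl h.le
    · exact Or.inr h.le
  have hreal : P.real {ω | ε < |(1 / (k : ℝ)) * ∑ i, X i ω - m|} ≤ δ := by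
    refine (measureReal_mono hincl).trans ((measureReal_union_le _ _).trans ?_)
    linarith [hup.trans hexp, hlow.trans hexp]
  rw [← ofReal_measureReal]
  exact ENNReal.ofReal_le_ofReal hreal

namespace SpanningRootedForest

variable {V : Type*} [Fintype V] {G : WDigraph V}

theorem weight_nonneg {V : Type*} {G : WDigraph V} (F : SpanningRootedForest G) : 0 ≤ F.weight :=
  Finset.prod_nonneg fun e he => (G.w_pos e.1 e.2 (F.edges_sub e.1 e.2 he)).le

/-- Hoeffding's inequality for the mean of a function of independent random forests. -/
theorem measure_abs_mean_sub_gt_le {Ω : Type*} [MeasurableSpace Ω] (P : Measure Ω)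
    [IsProbabilityMeasure P] {k : ℕ} {F : Fin k → Ω → SpanningRootedForest G}
    (hF : ∀ i, Measurable (F i)) (hind : iIndepFun F P)
    (hlaw : ∀ i f, P {ω | F i ω = f} =
      ENNReal.ofReal (f.weight / ∑ f' : SpanningRootedForest G, f'.weight))
    {φ : SpanningRootedForest G → ℝ} (h01 : ∀ f, φ f ∈ Set.Icc (0 : ℝ) 1) {m : ℝ}
    (hm : ∑ f : SpanningRootedForest G,
      (f.weight / ∑ f' : SpanningRootedForest G, f'.weight) * φ f = m)
    {ε δ : ℝ} (hε : 0 < ε) (hδ0 : 0 < δ) (hδ1 : δ < 1)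
    (hk : k = ⌈1 / (2 * ε ^ 2) * Real.log (2 / δ)⌉₊) :
    P {ω | ε < |(1 / (k : ℝ)) * ∑ i, φ (F i ω) - m|} ≤ ENNReal.ofReal δ := by
  have hφ : Measurable φ := measurable_from_top
  have : MeasurableSingletonClass (SpanningRootedForest G) := ⟨fun _ => trivial⟩
  refine _root_.measure_abs_mean_sub_gt_le P (fun i => hφ.comp (hF i)) (hind.comp (fun _ => φ)
    fun _ => hφ) (fun i ω => h01 _) (fun i => ?_) hε hδ0 hδ1 (hk ▸ Nat.le_ceil _)
  have hprob : IsProbabilityMeasure (P.map (F i)) :=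
    Measure.isProbabilityMeasure_map (hF i).aemeasurable
  rw [← hm]
  change ∫ ω, φ (F i ω) ∂P = _
  rw [← integral_map (hF i).aemeasurable hφ.aestronglyMeasurable,
    integral_fintype .of_finite]
  refine Finset.sum_congr rfl fun f _ => ?_
  rw [smul_eq_mul, Measure.real, Measure.map_apply (hF i) (measurableSet_singleton f)]
  congr 1
  change (P {ω | F i ω = f}).toReal = _
  rw [hlaw, ENNReal.toReal_ofReal]
  exact div_nonneg f.weight_nonneg (Finset.sum_nonneg fun f' _ => f'.weight_nonneg)

end SpanningRootedForest

/-- Almost sure termination is contained in the first claim, as the stated probabilities sum to one.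
For the means it remains to recognise `σ`, `σ̃` and `η` as expectations by `pprMatrix_apply`. -/
theorem mainTheorem3 {V : Type*} [Fintype V] [DecidableEq V]
    (G : WDigraph V) (hdeg : ∀ i, 0 < G.outDegree i)
    (α : ℝ) (hα0 : 0 < α) (hα1 : α < 1)
    (order : List V) (horder : ∀ u, u ∈ order) :
    -- RandomForest returns every spanning rooted forest with probability proportional to its weight
    (∀ f : SpanningRootedForest (G.reweight α hα0 hα1),
      RandomForest.prob (G.reweight α hα0 hα1) order f =
        ENNReal.ofReal
          (f.weight / ∑ f' : SpanningRootedForest (G.reweight α hα0 hα1), f'.weight)) ∧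
    -- the guarantee for the means over `ψ` independent runs of RandomForest
    ∀ (S : Finset V) (v : V) (ε δ : ℝ), 0 < ε → 0 < δ → δ < 1 →
      ∀ ψ : ℕ, ψ = ⌈1 / (2 * ε ^ 2) * Real.log (2 / δ)⌉₊ →
      ∀ {Ω : Type*} [MeasurableSpace Ω] (P : Measure Ω) [IsProbabilityMeasure P]
        (F : Fin ψ → Ω → SpanningRootedForest (G.reweight α hα0 hα1)),
        (∀ i, Measurable (F i)) → iIndepFun F P →
        (∀ i f, P {ω | F i ω = f} = RandomForest.prob (G.reweight α hα0 hα1) order f) →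
        ∀ s : V,
          P {ω | ε < |(1 / (ψ : ℝ)) *
              (∑ i, (((F i ω).rootedAt s).card : ℝ) / (Fintype.card V : ℝ)) - G.sigma α s|}
            ≤ ENNReal.ofReal δ ∧
          P {ω | ε < |(1 / (ψ : ℝ)) *
              (∑ i, if (F i ω).root v = s then (1 : ℝ) else 0) - G.sigmaTilde α v s|}
            ≤ ENNReal.ofReal δ ∧
          P {ω | ε < |(1 / (ψ : ℝ)) *
              (∑ i, if (F i ω).root s ∈ S then (1 : ℝ) else 0) - G.eta α S s|}
            ≤ ENNReal.ofReal δ := by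
  refine ⟨RandomForest.prob_eq _ horder, ?_⟩
  intro S v ε δ hε hδ0 hδ1 ψ hψ Ω _ P _ F hF hind hlaw s
  have hlaw' := fun i f => (hlaw i f).trans (RandomForest.prob_eq _ horder f)
  refine ⟨?_, ?_, ?_⟩
  · have hn : (0 : ℝ) < Fintype.card V := by exact_mod_cast Fintype.card_pos_iff.2 ⟨v⟩
    refine SpanningRootedForest.measure_abs_mean_sub_gt_le P hF hind hlaw'
      (φ := fun f => ((f.rootedAt s).card : ℝ) / (Fintype.card V : ℝ))
      (fun f => ⟨by positivity, ?_⟩) ?_ hε hδ0 hδ1 hψ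
    · rw [div_le_one hn]
      exact_mod_cast Finset.card_le_univ _
    · simp only [WDigraph.sigma, Pi.smul_apply, Matrix.vecMul, dotProduct, one_mul, smul_eq_mul,
        G.pprMatrix_apply hα0 hα1 hdeg]
      -- Summing the column `s` of `Π` over all nodes counts, for each forest, the nodes rooted at
      -- `s`.
      rw [Finset.sum_comm, Finset.mul_sum]
      refine Finset.sum_congr rfl fun f _ => ?_
      rw [← Finset.mul_sum, SpanningRootedForest.rootedAt, Finset.card_filter]
      push_cast
      ring
  · refine SpanningRootedForest.measure_abs_mean_sub_gt_le P hF hind hlaw'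
      (φ := fun f => if f.root v = s then (1 : ℝ) else 0) (fun f => ?_) ?_ hε hδ0 hδ1 hψ
    · split_ifs <;> simp
    · simp [WDigraph.sigmaTilde, G.pprMatrix_apply hα0 hα1 hdeg]
  · refine SpanningRootedForest.measure_abs_mean_sub_gt_le P hF hind hlaw'
      (φ := fun f => if f.root s ∈ S then (1 : ℝ) else 0) (fun f => ?_) ?_ hε hδ0 hδ1 hψ
    · split_ifs <;> simp
    · simp only [WDigraph.eta, Matrix.mulVec, dotProduct, G.pprMatrix_apply hα0 hα1 hdeg]
      simp only [Finset.sum_mul]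
      rw [Finset.sum_comm]
      refine Finset.sum_congr rfl fun f _ => ?_
      simp
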